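/- **Machine.** Fix a set $V$ of values (also used as addresses and program points), a set of register names, a set of opcodes with evaluation functions $[\![o]\!]:V^*\to V$, Boolean branch conditions $V^*\to\{\mathsf{true},\mathsf{false}\}$, an address function $\mathrm{addr}:V^*\to V$, and a lattice of security labels with least element (public). A configuration is $C=(\rho,\mu,n,\mathit{buf})$: a partial map $\rho$ from registers to labelled values, a memory $\mu$ consisting of a partial map from addresses to labelled values and a fixed (never overwritten) partial map from program points to instructions, a program point $n$, and a reorder buffer, i.e. a partial map from $\mathbb N$ to transient instructions. It is *initial* if the buffer is empty. The physical instructions are $r=\mathrm{op}(o,\vec{rv},n')$, $r=\mathrm{load}(\vec{rv},n')$, $\mathrm{store}(rv,\vec{rv},n')$, $\mathrm{br}(o,\vec{rv},n^{\mathsf{true}},n^{\mathsf{false}})$ and $\mathrm{fence}\ n'$, where each $rv$ is a register or a labelled value. At buffer index $i$ a register resolves to the value of its latest assignment at an index $<i$ (undefined if that assignment is unresolved), or to $\rho(r)$ if there is no such assignment. Results, addresses and branch conditions carry the join of the labels of their operands. The directives and their effects are as follows; no execute directive applies to an index above a fence. * $\mathsf{fetch}$ appends the (unresolved) transient form of the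 current non-branch instruction at index $\max(\mathit{buf})+1$ (with $\max\emptyset=0$) and moves to $n'$. $\mathsf{fetch}:b$ does so for a branch, moving to $n^b$ and recording $n_0=n^b$. * $\mathsf{execute}\ i$ resolves an op. For a load with labelled address $a_\ell$ it takes the value from the latest older store whose address is resolved to $a$ (whose data must be resolved), observing $\mathsf{fwd}\ a_\ell$, or from memory if there is none, observing $\mathsf{read}\ a_\ell$; the entry records the store's index $j$ (or $\bot$), the address, and the program point of the load. For a branch whose true target is $n'$ with label $\ell$: if $n'=n_0$ the entry becomes $\mathsf{jump}\ n_0$, observing $\mathsf{jump}\ (n_0)_\ell$; otherwise all entries at indices $\ge i$ are removed, $\mathsf{jump}\ n'$ is put at $i$, execution continues at $n'$, and $\mathsf{rollback},\mathsf{jump}\ n'_\ell$ is observed. * $\mathsf{execute}\ i:\mathsf{value}$ resolves the data of a store. $\mathsf{execute}\ i:\mathsf{addr}$ resolves its address $a_\ell$, observing $\mathsf{fwd}\ a_\ell$. There is a hazard at $k>i$ if entry $k$ is a resolved load that read from $a$ with $j_k<i$ (where $\bot<i$), or that has $j_k=i$ but another address. If there are hazards and $k$ is the least one, additionally all entries at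 indices $\ge k$ are removed, execution continues at the program point of that load, and $\mathsf{rollback}$ is observed as well. * $\mathsf{retire}$ removes the oldest entry if it is fully resolved: assignments are written to $\rho$; a store is written to $\mu$, observing $\mathsf{write}\ a_\ell$; resolved branches and fences are just removed. A schedule $D$ is a list of directives; $C\Downarrow_D^O C'$ means that $D$ can be executed from $C$, leading to $C'$ with trace (sequence of observations) $O$. The execution has *speculation bound* $n$ if the buffer never holds more than $n$ entries. A trace contains a label if one of its observations carries it. **Tool schedules.** For an initial $C$ and $n\in\mathbb N$, $D_T(n)$ is the least set of schedules containing the empty one and such that, whenever $D_0\in D_T(n)$ and $C\Downarrow_{D_0}C_0$: * if $|C_0.\mathit{buf}|<n$ and the next instruction, to be fetched to index $i$, is * an op or a load, then $D_0;\mathsf{fetch};\mathsf{execute}\ i\in D_T(n)$; * a store, then $D_0;\mathsf{fetch};\mathsf{execute}\ i:\mathsf{value}$ and $D_0;\mathsf{fetch};\mathsf{execute}\ i:\mathsf{value};\mathsf{execute}\ i:\mathsf{addr}$ are in $D_T(n)$; * a branch whose condition, resolved at $i$, is $b$, then $D_0;\mathsf{fetch}:b;\mathsf{execute}\ i$ and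 $D_0;\mathsf{fetch}:\lnot b$ are in $D_T(n)$; * if $|C_0.\mathit{buf}|=n$ and the oldest entry, at index $i$, is a store with unresolved address whose resolution causes no hazard, then $D_0;\mathsf{execute}\ i:\mathsf{addr};\mathsf{retire}\in D_T(n)$; otherwise, if the oldest entry is fully resolved, then $D_0;\mathsf{retire}\in D_T(n)$. **Theorem (Soundness of the tool).** Let $C$ be an initial configuration whose program consists of op, load, store and branch instructions (no fences), and let $n\in\mathbb N$. Assume that no execution of $C$ with speculation bound $n$ meets an undefined read: in every configuration reached, $\rho$ is defined at every register operand of a buffer entry for which no assignment is pending at an earlier index, and $\mu$ is defined at the address of every unresolved load whose address operands resolve and for which no older store in the buffer has its address resolved to that address. (This holds in particular if $\rho$ and the data part of $\mu$ are total.) If some schedule $D$ has an execution $C\Downarrow_D^O C_1$ with speculation bound $n$ whose trace $O$ contains a secret label, then there are $D_t\in D_T(n)$, $O_t$ and $C_t$ such that $C\Downarrow_{D_t}^{O_t}C_t$ and $O_t$ contains a secret label. -/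

import Mathlib

/-!
A three-stage (fetch, execute, retire) speculative out-of-order machine with reorder buffer,
branch prediction, store-to-load forwarding and memory hazards, and the restricted set of
worst-case schedules examined by the analysis tool.
-/

namespace SpecCT

/-- A value annotated with a security label. -/
structure LVal (V L : Type*) where
  val : V
  label : L

/-- The join of the labels of a list of labelled values (`⊥` is the public label). -/
def joinLabels {V L : Type*} [Lattice L] [OrderBot L] (vs : List (LVal V L)) : L :=
  vs.foldr (fun v l => v.label ⊔ l) ⊥

/-- The evaluation functions of the instruction set: arithmetic opcodes, branch conditions and
the computation of an address from its operands. -/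
structure Machine (V Op : Type*) where
  evalOp : Op → List V → V
  evalCond : Op → List V → Bool
  addr : List V → V

/-- An operand is a register or an immediate labelled value. -/
inductive Operand (V R L : Type*) where
  | reg (r : R)
  | imm (v : LVal V L)

/-- Physical instructions. The arguments `next`, `nTrue`, `nFalse` are program points. -/
inductive Instr (V R Op L : Type*) where
  | op (o : Op) (r : R) (args : List (Operand V R L)) (next : V)
  | load (r : R) (args : List (Operand V R L)) (next : V)
  | store (src : Operand V R L) (args : List (Operand V R L)) (next : V)
  | br (o : Op) (args : List (Operand V R L)) (nTrue nFalse : V)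
  | fence (next : V)

/-- Transient instructions, the entries of the reorder buffer. -/
inductive Transient (V R Op L : Type*) where
  /-- unresolved arithmetic operation -/
  | op (o : Op) (r : R) (args : List (Operand V R L))
  /-- resolved arithmetic operation -/
  | val (r : R) (v : LVal V L)
  /-- unresolved load, fetched at program point `n` -/
  | load (r : R) (args : List (Operand V R L)) (n : V)
  /-- resolved load from address `a`, fetched at program point `n`: the value `v` was forwarded
  from the store at buffer index `j`, or read from memory if `j` is `none` -/
  | loaded (r : R) (v : LVal V L) (j : Option ℕ) (a : V) (n : V)
  /-- store with unresolved address; its data is resolved when `src` is an immediate value -/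
  | store (src : Operand V R L) (args : List (Operand V R L))
  /-- store with resolved, labelled address `a` -/
  | storeAt (src : Operand V R L) (a : LVal V L)
  /-- unresolved conditional branch, speculatively continued at `n₀` -/
  | br (o : Op) (args : List (Operand V R L)) (n₀ nTrue nFalse : V)
  /-- resolved conditional branch -/
  | jump (n₀ : V)
  /-- speculation fence -/
  | fence

/-- The register assigned by a transient instruction, resolved or not. -/
def Transient.dest {V R Op L : Type*} : Transient V R Op L → Option R
  | .op _ r _ => some r
  | .val r _ => some r
  | .load r _ _ => some r
  | .loaded r _ _ _ _ => some r
  | _ => none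

/-- The value that a transient instruction assigns to its register, once it is resolved. -/
def Transient.result {V R Op L : Type*} : Transient V R Op L → Option (LVal V L)
  | .val _ v => some v
  | .loaded _ v _ _ _ => some v
  | _ => none

/-- The operands that a transient instruction still has to read when it is executed. -/
def Transient.operands {V R Op L : Type*} : Transient V R Op L → List (Operand V R L)
  | .op _ _ args => args
  | .load _ args _ => args
  | .store src args => src :: args
  | .storeAt src _ => [src]
  | .br _ args _ _ _ => args
  | _ => []

/-- No execution step of the transient instruction is left to be done. -/
def Transient.FullyResolved {V R Op L : Type*} : Transient V R Op L → Prop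
  | .val _ _ => True
  | .loaded _ _ _ _ _ => True
  | .storeAt (.imm _) _ => True
  | .jump _ => True
  | .fence => True
  | _ => False

/-- Update of a partial map. -/
noncomputable def update {α β : Type*} (f : α → Option β) (a : α) (b : β) : α → Option β :=
  open Classical in fun x => if x = a then some b else f x

/-- Reorder buffers: partial maps from buffer indices to transient instructions. -/
abbrev Buffer (V R Op L : Type*) := ℕ → Option (Transient V R Op L)

namespace Buffer

variable {V R Op L : Type*}

/-- The domain of the buffer. -/
def dom (buf : Buffer V R Op L) : Set ℕ := {i | buf i ≠ none}

/-- The number of entries. -/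
noncomputable def size (buf : Buffer V R Op L) : ℕ := buf.dom.ncard

/-- The least index of the buffer, `0` if it is empty. -/
noncomputable def minIdx (buf : Buffer V R Op L) : ℕ := sInf buf.dom

/-- The greatest index of the buffer, `0` if it is empty. -/
noncomputable def maxIdx (buf : Buffer V R Op L) : ℕ := sSup buf.dom

/-- The index at which the next instruction is fetched. -/
noncomputable def fresh (buf : Buffer V R Op L) : ℕ := buf.maxIdx + 1

/-- Restriction to the indices below `i`. -/
def below (buf : Buffer V R Op L) (i : ℕ) : Buffer V R Op L :=
  fun j => if j < i then buf j else none

/-- Restriction to the indices above `i`. -/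
def above (buf : Buffer V R Op L) (i : ℕ) : Buffer V R Op L :=
  fun j => if i < j then buf j else none

/-- The entry at index `j` is a (resolved or unresolved) assignment to `r`. -/
def Assigns (buf : Buffer V R Op L) (j : ℕ) (r : R) : Prop :=
  ∃ t, buf j = some t ∧ t.dest = some r

/-- The entry at index `j` is a store whose address is resolved to `a`. -/
def StoresTo (buf : Buffer V R Op L) (j : ℕ) (a : V) : Prop :=
  ∃ src l, buf j = some (.storeAt src ⟨a, l⟩)

/-- No fence stands before index `i`. -/
def NoFence (buf : Buffer V R Op L) (i : ℕ) : Prop := ∀ j < i, buf j ≠ some .fence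

/-- When the address of the store at index `i` turns out to be `a`, the resolved load at index
`k > i`, fetched at program point `nk`, is found to hold wrong data: it read from `a` but took
its value from memory or from a store older than `i`, or it took its value from `i` but read
from another address. -/
def HazardAt (buf : Buffer V R Op L) (i : ℕ) (a : V) (k : ℕ) (nk : V) : Prop :=
  i < k ∧ ∃ r v j ak, buf k = some (.loaded r v j ak nk) ∧
    ((ak = a ∧ ∀ j₀, j = some j₀ → j₀ < i) ∨ (j = some i ∧ ak ≠ a))

end Buffer

/-- Configurations. The memory consists of a part that maps addresses to labelled data and a part
that maps program points to instructions; the latter is never written. -/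
structure Config (V R Op L : Type*) where
  reg : R → Option (LVal V L)
  mem : V → Option (LVal V L)
  prog : V → Option (Instr V R Op L)
  pc : V
  buf : Buffer V R Op L

/-- A configuration is initial if its reorder buffer is empty. -/
def Config.Initial {V R Op L : Type*} (C : Config V R Op L) : Prop := ∀ i, C.buf i = none

/-- The register resolve function at buffer index `i`, as a functional relation: it is
undefined if the latest assignment to `r` before `i` is unresolved, or if there is none and the
register map is undefined at `r`. -/
inductive Config.ResolvesReg {V R Op L : Type*} (C : Config V R Op L) (i : ℕ) (r : R) :
    LVal V L → Prop
  | pending {j : ℕ} {t : Transient V R Op L} {v : LVal V L} (hj : j < i)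
      (ht : C.buf j = some t) (hr : t.dest = some r)
      (hlast : ∀ k, j < k → k < i → ¬ C.buf.Assigns k r) (hv : t.result = some v) :
      ResolvesReg C i r v
  | regfile {v : LVal V L} (hnone : ∀ j < i, ¬ C.buf.Assigns j r) (hv : C.reg r = some v) :
      ResolvesReg C i r v

/-- Extension of the register resolve function to operands. -/
inductive Config.Resolves {V R Op L : Type*} (C : Config V R Op L) (i : ℕ) :
    Operand V R L → LVal V L → Prop
  | reg {r : R} {v : LVal V L} (h : C.ResolvesReg i r v) : Resolves C i (.reg r) v
  | imm (v : LVal V L) : Resolves C i (.imm v) v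

/-- Pointwise extension of the register resolve function to lists of operands. -/
def Config.ResolvesList {V R Op L : Type*} (C : Config V R Op L) (i : ℕ)
    (args : List (Operand V R L)) (vs : List (LVal V L)) : Prop :=
  List.Forall₂ (C.Resolves i) args vs

/-- The operands `args`, resolved at index `i`, yield the labelled address `a`. -/
def Config.ResolvesAddr {V R Op L : Type*} [Lattice L] [OrderBot L] (M : Machine V Op)
    (C : Config V R Op L) (i : ℕ) (args : List (Operand V R L)) (a : LVal V L) : Prop :=
  ∃ vs, C.ResolvesList i args vs ∧ a = ⟨M.addr (vs.map LVal.val), joinLabels vs⟩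

/-- The branch condition `o(args)`, resolved at index `i`, yields the truth value `b` with
label `l`. -/
def Config.ResolvesCond {V R Op L : Type*} [Lattice L] [OrderBot L] (M : Machine V Op)
    (C : Config V R Op L) (i : ℕ) (o : Op) (args : List (Operand V R L)) (b : Bool) (l : L) :
    Prop :=
  ∃ vs, C.ResolvesList i args vs ∧ b = M.evalCond o (vs.map LVal.val) ∧ l = joinLabels vs

/-- Attacker directives. -/
inductive Directive where
  | fetch
  | fetchGuess (b : Bool)
  | execute (i : ℕ)
  | executeValue (i : ℕ)
  | executeAddr (i : ℕ)
  | retire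

/-- Observations. -/
inductive Obs (V L : Type*) where
  | read (a : LVal V L)
  | fwd (a : LVal V L)
  | write (a : LVal V L)
  | jump (n : LVal V L)
  | rollback

/-- The observation carries the label `l`. -/
def Obs.HasLabel {V L : Type*} : Obs V L → L → Prop
  | .read a, l => a.label = l
  | .fwd a, l => a.label = l
  | .write a, l => a.label = l
  | .jump n, l => n.label = l
  | .rollback, _ => False

/-- The program point on the side `b` of a conditional branch. -/
def branchTarget {V : Type*} (nTrue nFalse : V) (b : Bool) : V := if b then nTrue else nFalse

/-- `Step M C d o C₁`: under directive `d`, configuration `C` steps to `C₁` and produces the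
observations `o`. -/
inductive Step {V R Op L : Type*} [Lattice L] [OrderBot L] (M : Machine V Op) :
    Config V R Op L → Directive → List (Obs V L) → Config V R Op L → Prop
  | op_fetch {C : Config V R Op L} {o r args next}
      (hp : C.prog C.pc = some (.op o r args next)) :
      Step M C .fetch []
        { C with pc := next, buf := update C.buf C.buf.fresh (.op o r args) }
  | load_fetch {C : Config V R Op L} {r args next}
      (hp : C.prog C.pc = some (.load r args next)) :
      Step M C .fetch []
        { C with pc := next, buf := update C.buf C.buf.fresh (.load r args C.pc) }
  | store_fetch {C : Config V R Op L} {src args next}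
      (hp : C.prog C.pc = some (.store src args next)) :
      Step M C .fetch []
        { C with pc := next, buf := update C.buf C.buf.fresh (.store src args) }
  | fence_fetch {C : Config V R Op L} {next}
      (hp : C.prog C.pc = some (.fence next)) :
      Step M C .fetch [] { C with pc := next, buf := update C.buf C.buf.fresh .fence }
  | br_fetch {C : Config V R Op L} {o args nTrue nFalse} (b : Bool)
      (hp : C.prog C.pc = some (.br o args nTrue nFalse)) :
      Step M C (.fetchGuess b) []
        { C with
          pc := branchTarget nTrue nFalse b,
          buf := update C.buf C.buf.fresh
            (.br o args (branchTarget nTrue nFalse b) nTrue nFalse) }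
  | op_execute {C : Config V R Op L} {i : ℕ} {o r args vs}
      (hi : C.buf i = some (.op o r args)) (hf : C.buf.NoFence i)
      (hargs : C.ResolvesList i args vs) :
      Step M C (.execute i) []
        { C with
          buf := update C.buf i
            (.val r ⟨M.evalOp o (vs.map LVal.val), joinLabels vs⟩) }
  | br_execute_correct {C : Config V R Op L} {i : ℕ} {o args n₀ nTrue nFalse b l}
      (hi : C.buf i = some (.br o args n₀ nTrue nFalse)) (hf : C.buf.NoFence i)
      (hargs : C.ResolvesCond M i o args b l) (hb : branchTarget nTrue nFalse b = n₀) :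
      Step M C (.execute i) [.jump ⟨n₀, l⟩] { C with buf := update C.buf i (.jump n₀) }
  | br_execute_incorrect {C : Config V R Op L} {i : ℕ} {o args n₀ nTrue nFalse b l}
      (hi : C.buf i = some (.br o args n₀ nTrue nFalse)) (hf : C.buf.NoFence i)
      (hargs : C.ResolvesCond M i o args b l) (hb : branchTarget nTrue nFalse b ≠ n₀) :
      Step M C (.execute i) [.rollback, .jump ⟨branchTarget nTrue nFalse b, l⟩]
        { C with
          pc := branchTarget nTrue nFalse b,
          buf := update (C.buf.below i) i (.jump (branchTarget nTrue nFalse b)) }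
  | load_execute_nodep {C : Config V R Op L} {i : ℕ} {r args n a v}
      (hi : C.buf i = some (.load r args n)) (hf : C.buf.NoFence i)
      (hargs : C.ResolvesAddr M i args a) (hst : ∀ j < i, ¬ C.buf.StoresTo j a.val)
      (hv : C.mem a.val = some v) :
      Step M C (.execute i) [.read a]
        { C with buf := update C.buf i (.loaded r v none a.val n) }
  | load_execute_forward {C : Config V R Op L} {i j : ℕ} {r args n a v la}
      (hi : C.buf i = some (.load r args n)) (hf : C.buf.NoFence i)
      (hargs : C.ResolvesAddr M i args a) (hj : j < i)
      (hst : C.buf j = some (.storeAt (.imm v) ⟨a.val, la⟩))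
      (hlast : ∀ k, j < k → k < i → ¬ C.buf.StoresTo k a.val) :
      Step M C (.execute i) [.fwd a]
        { C with buf := update C.buf i (.loaded r v (some j) a.val n) }
  | store_execute_value {C : Config V R Op L} {i : ℕ} {src args v}
      (hi : C.buf i = some (.store src args)) (hf : C.buf.NoFence i)
      (hv : C.Resolves i src v) :
      Step M C (.executeValue i) [] { C with buf := update C.buf i (.store (.imm v) args) }
  | storeAt_execute_value {C : Config V R Op L} {i : ℕ} {src a v}
      (hi : C.buf i = some (.storeAt src a)) (hf : C.buf.NoFence i)
      (hv : C.Resolves i src v) :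
      Step M C (.executeValue i) [] { C with buf := update C.buf i (.storeAt (.imm v) a) }
  | store_execute_addr_ok {C : Config V R Op L} {i : ℕ} {src args a}
      (hi : C.buf i = some (.store src args)) (hf : C.buf.NoFence i)
      (hargs : C.ResolvesAddr M i args a) (hok : ∀ k nk, ¬ C.buf.HazardAt i a.val k nk) :
      Step M C (.executeAddr i) [.fwd a] { C with buf := update C.buf i (.storeAt src a) }
  | store_execute_addr_hazard {C : Config V R Op L} {i k : ℕ} {src args a nk}
      (hi : C.buf i = some (.store src args)) (hf : C.buf.NoFence i)
      (hargs : C.ResolvesAddr M i args a) (hk : C.buf.HazardAt i a.val k nk)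
      (hmin : ∀ k₁ < k, ∀ n₁, ¬ C.buf.HazardAt i a.val k₁ n₁) :
      Step M C (.executeAddr i) [.rollback, .fwd a]
        { C with pc := nk, buf := update (C.buf.below k) i (.storeAt src a) }
  | value_retire {C : Config V R Op L} {r v}
      (hi : C.buf C.buf.minIdx = some (.val r v)) :
      Step M C .retire []
        { C with reg := update C.reg r v, buf := C.buf.above C.buf.minIdx }
  | load_retire {C : Config V R Op L} {r v j a n}
      (hi : C.buf C.buf.minIdx = some (.loaded r v j a n)) :
      Step M C .retire []
        { C with reg := update C.reg r v, buf := C.buf.above C.buf.minIdx }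
  | store_retire {C : Config V R Op L} {v a}
      (hi : C.buf C.buf.minIdx = some (.storeAt (.imm v) a)) :
      Step M C .retire [.write a]
        { C with mem := update C.mem a.val v, buf := C.buf.above C.buf.minIdx }
  | jump_retire {C : Config V R Op L} {n₀}
      (hi : C.buf C.buf.minIdx = some (.jump n₀)) :
      Step M C .retire [] { C with buf := C.buf.above C.buf.minIdx }
  | fence_retire {C : Config V R Op L}
      (hi : C.buf C.buf.minIdx = some .fence) :
      Step M C .retire [] { C with buf := C.buf.above C.buf.minIdx }

/-- `Exec M C D O C₁`: executing the schedule `D` from `C` leads to `C₁` with trace `O`; in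
particular `D` is a well-formed schedule for `C`. -/
inductive Exec {V R Op L : Type*} [Lattice L] [OrderBot L] (M : Machine V Op)
    (C : Config V R Op L) : List Directive → List (Obs V L) → Config V R Op L → Prop
  | nil : Exec M C [] [] C
  | snoc {D : List Directive} {O : List (Obs V L)} {C₁ : Config V R Op L} {d : Directive}
      {o : List (Obs V L)} {C₂ : Config V R Op L} (h : Exec M C D O C₁)
      (hstep : Step M C₁ d o C₂) : Exec M C (D ++ [d]) (O ++ o) C₂

/-- Execution with speculation bound `n`: an execution in which the reorder buffer never holds
more than `n` entries. -/
inductive BoundedExec {V R Op L : Type*} [Lattice L] [OrderBot L] (M : Machine V Op) (n : ℕ)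
    (C : Config V R Op L) : List Directive → List (Obs V L) → Config V R Op L → Prop
  | nil (hsize : C.buf.size ≤ n) : BoundedExec M n C [] [] C
  | snoc {D : List Directive} {O : List (Obs V L)} {C₁ : Config V R Op L} {d : Directive}
      {o : List (Obs V L)} {C₂ : Config V R Op L} (h : BoundedExec M n C D O C₁)
      (hstep : Step M C₁ d o C₂) (hsize : C₂.buf.size ≤ n) :
      BoundedExec M n C (D ++ [d]) (O ++ o) C₂

/-- The trace contains the label `l`. -/
def TraceHasLabel {V L : Type*} (O : List (Obs V L)) (l : L) : Prop := ∃ o ∈ O, o.HasLabel l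

/-- No execution of `C` with speculation bound `n` meets an undefined read: a register operand
without pending assignment has a value in the register map, and a load that is not forwarded
finds its address in the domain of the memory. -/
def FaultFree {V R Op L : Type*} [Lattice L] [OrderBot L] (M : Machine V Op) (n : ℕ)
    (C : Config V R Op L) : Prop :=
  ∀ D O C₁, BoundedExec M n C D O C₁ → ∀ i t, C₁.buf i = some t →
    (∀ r, Operand.reg r ∈ t.operands → (∀ j < i, ¬ C₁.buf.Assigns j r) → C₁.reg r ≠ none) ∧
    (∀ r args m a, t = .load r args m → C₁.ResolvesAddr M i args a →
      (∀ j < i, ¬ C₁.buf.StoresTo j a.val) → C₁.mem a.val ≠ none)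

/-- The set of tool schedules for the initial configuration `C` and the speculation bound
`n`. -/
inductive ToolSchedules {V R Op L : Type*} [Lattice L] [OrderBot L] (M : Machine V Op)
    (C : Config V R Op L) (n : ℕ) : Set (List Directive)
  | nil : ToolSchedules M C n []
  | op {D O C₀ o r args next} (h : ToolSchedules M C n D) (hex : Exec M C D O C₀)
      (hsize : C₀.buf.size < n) (hp : C₀.prog C₀.pc = some (.op o r args next)) :
      ToolSchedules M C n (D ++ [.fetch, .execute C₀.buf.fresh])
  | load {D O C₀ r args next} (h : ToolSchedules M C n D) (hex : Exec M C D O C₀)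
      (hsize : C₀.buf.size < n) (hp : C₀.prog C₀.pc = some (.load r args next)) :
      ToolSchedules M C n (D ++ [.fetch, .execute C₀.buf.fresh])
  | store_unresolved {D O C₀ src args next} (h : ToolSchedules M C n D) (hex : Exec M C D O C₀)
      (hsize : C₀.buf.size < n) (hp : C₀.prog C₀.pc = some (.store src args next)) :
      ToolSchedules M C n (D ++ [.fetch, .executeValue C₀.buf.fresh])
  | store_resolved {D O C₀ src args next} (h : ToolSchedules M C n D) (hex : Exec M C D O C₀)
      (hsize : C₀.buf.size < n) (hp : C₀.prog C₀.pc = some (.store src args next)) :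
      ToolSchedules M C n
        (D ++ [.fetch, .executeValue C₀.buf.fresh, .executeAddr C₀.buf.fresh])
  | br_correct {D O C₀ o args nTrue nFalse b l} (h : ToolSchedules M C n D)
      (hex : Exec M C D O C₀) (hsize : C₀.buf.size < n)
      (hp : C₀.prog C₀.pc = some (.br o args nTrue nFalse))
      (hb : C₀.ResolvesCond M C₀.buf.fresh o args b l) :
      ToolSchedules M C n (D ++ [.fetchGuess b, .execute C₀.buf.fresh])
  | br_incorrect {D O C₀ o args nTrue nFalse b l} (h : ToolSchedules M C n D)
      (hex : Exec M C D O C₀) (hsize : C₀.buf.size < n)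
      (hp : C₀.prog C₀.pc = some (.br o args nTrue nFalse))
      (hb : C₀.ResolvesCond M C₀.buf.fresh o args b l) :
      ToolSchedules M C n (D ++ [.fetchGuess (!b)])
  | retire_store {D O C₀ src args a} (h : ToolSchedules M C n D) (hex : Exec M C D O C₀)
      (hsize : C₀.buf.size = n) (hi : C₀.buf C₀.buf.minIdx = some (.store src args))
      (hargs : C₀.ResolvesAddr M C₀.buf.minIdx args a)
      (hok : ∀ k nk, ¬ C₀.buf.HazardAt C₀.buf.minIdx a.val k nk) :
      ToolSchedules M C n (D ++ [.executeAddr C₀.buf.minIdx, .retire])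
  | retire {D O C₀ t} (h : ToolSchedules M C n D) (hex : Exec M C D O C₀)
      (hsize : C₀.buf.size = n) (hi : C₀.buf C₀.buf.minIdx = some t) (ht : t.FullyResolved) :
      ToolSchedules M C n (D ++ [.retire])

end SpecCT

/-! All that out-of-order execution, wrong guesses and rollbacks leave behind is the list of entries
retired so far followed by those in the buffer. The effect of entries on registers and memory is
folded into a `View`, and the machine's resolve functions are lookups in the view past the older
entries (`Config.resolvesReg_iff`, `Config.readsFrom_iff`). The invariant `Trail` says that retired
and buffered entries form a history `Hist`: each is a correct, possibly unresolved, form of the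
instruction at its program point, in the view past its predecessors. Most resolutions only make
later views more defined, and justification is monotone (`Hist.mono`). The exception is a late store
address, which changes the memory under younger loads; the hazard check guarantees that each
surviving load from that address is shielded by a store in between (`Trail.resolve_addr`).

A labelled observation comes from a buffer entry whose instruction leaks the label in the view past
its predecessors (`Trail.exists_leaks`). So it suffices that a tool schedule follows the history up
to this entry. In `ToolRun.simulate` each instruction is executed as soon as it is fetched, except
that a store address stays unresolved where the history has it unresolved, and a wrong guess stays
pending where the history has one. The view of the tool is then at least as defined, hence yields
the same addresses and conditions, and fault freedom ensures that it never gets stuck.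

The tool must retire whenever it holds `n` entries. The leaking entry lies in a buffer of at most
`n` entries, so fewer than `n` of its predecessors are not yet retired. Hence the oldest entry of a
full tool buffer corresponds to a retired one; that one was fully resolved, and so is its
counterpart (`exists_toolRun`). Resolving a store address upon retirement is never needed. -/

namespace SpecCT

variable {V R Op L : Type*}

/-! ### Views: what the registers and the memory look like from a position in the buffer -/

/-- Update of a partial map by a possibly undefined value. -/
noncomputable def assign {α β : Type*} (f : α → Option β) (a : α) (b : Option β) : α → Option β :=
  open Classical in fun x => if x = a then b else f x

theorem assign_same {α β : Type*} (f : α → Option β) (a : α) (b : Option β) :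
    assign f a b a = b := by
  simp [assign]

theorem assign_of_ne {α β : Type*} (f : α → Option β) {a x : α} (b : Option β) (h : x ≠ a) :
    assign f a b x = f x := by
  simp [assign, h]

theorem update_same {α β : Type*} (f : α → Option β) (a : α) (b : β) :
    update f a b a = some b := by
  simp [update]

theorem update_of_ne {α β : Type*} (f : α → Option β) {a x : α} (b : β) (h : x ≠ a) :
    update f a b x = f x := by
  simp [update, h]

/-- The value of an operand that needs no register. -/
def Operand.data : Operand V R L → Option (LVal V L)
  | .reg _ => none
  | .imm v => some v

/-- The registers and the memory as seen by an instruction. -/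
structure View (V R L : Type*) where
  reg : R → Option (LVal V L)
  mem : V → Option (LVal V L)

namespace View

/-- The view past a buffer entry. -/
noncomputable def apply (s : View V R L) : Transient V R Op L → View V R L
  | .op _ r _ => { s with reg := assign s.reg r none }
  | .val r v => { s with reg := assign s.reg r (some v) }
  | .load r _ _ => { s with reg := assign s.reg r none }
  | .loaded r v _ _ _ => { s with reg := assign s.reg r (some v) }
  | .storeAt src a => { s with mem := assign s.mem a.val src.data }
  | _ => s

/-- The view past a list of buffer entries. -/
noncomputable def applyAll (s : View V R L) (l : List (Transient V R Op L)) : View V R L :=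
  l.foldl apply s

theorem applyAll_append (s : View V R L) (l₁ l₂ : List (Transient V R Op L)) :
    s.applyAll (l₁ ++ l₂) = (s.applyAll l₁).applyAll l₂ := by
  simp [applyAll]

theorem applyAll_concat (s : View V R L) (l : List (Transient V R Op L)) (t) :
    s.applyAll (l ++ [t]) = (s.applyAll l).apply t := by
  simp [applyAll]

/-- Everything defined in the first view has the same value in the second. -/
def Le (s s' : View V R L) : Prop :=
  (∀ r v, s.reg r = some v → s'.reg r = some v) ∧ (∀ a v, s.mem a = some v → s'.mem a = some v)

theorem Le.refl (s : View V R L) : s.Le s := ⟨fun _ _ h => h, fun _ _ h => h⟩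

end View

theorem assign_le {α β : Type*} {f g : α → Option β} (h : ∀ x v, f x = some v → g x = some v)
    (a : α) {b c : Option β} (hbc : ∀ v, b = some v → c = some v) (x : α) (v : β) :
    assign f a b x = some v → assign g a c x = some v := by
  by_cases hx : x = a
  · subst hx; simpa [assign_same] using hbc v
  · simpa [assign_of_ne _ _ hx] using h x v

namespace View

/-- What an entry writes does not depend on the view. -/
theorem Le.apply {s s' : View V R L} (h : s.Le s') (t : Transient V R Op L) :
    (s.apply t).Le (s'.apply t) := by
  cases t <;> first
    | exact h
    | exact ⟨assign_le h.1 _ (fun _ e => e), h.2⟩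
    | exact ⟨h.1, assign_le h.2 _ (fun _ e => e)⟩

/-- The value of an operand in a view. -/
def Eval (s : View V R L) : Operand V R L → LVal V L → Prop
  | .reg r, v => s.reg r = some v
  | .imm w, v => w = v

/-- Pointwise extension of `View.Eval` to lists of operands. -/
def EvalList (s : View V R L) (args : List (Operand V R L)) (vs : List (LVal V L)) : Prop :=
  List.Forall₂ s.Eval args vs

theorem Eval.mono {s s' : View V R L} (h : s.Le s') {a : Operand V R L} {v}
    (e : s.Eval a v) : s'.Eval a v := by
  cases a with
  | reg r => exact h.1 _ _ e
  | imm w => exact e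

theorem EvalList.mono {s s' : View V R L} (h : s.Le s') {args : List (Operand V R L)} {vs}
    (e : s.EvalList args vs) : s'.EvalList args vs :=
  List.Forall₂.imp (fun _ _ e => e.mono h) e

theorem Eval.unique {s : View V R L} {a : Operand V R L} {v w} (e : s.Eval a v)
    (e' : s.Eval a w) : v = w := by
  cases a with
  | reg r => exact Option.some.inj (e.symm.trans e')
  | imm u => exact e.symm.trans e'

theorem EvalList.unique {s : View V R L} {args : List (Operand V R L)} {vs ws}
    (e : s.EvalList args vs) (e' : s.EvalList args ws) : vs = ws := by
  induction e generalizing ws with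
  | nil => cases e'; rfl
  | cons h _ ih =>
    cases e' with
    | cons h' t' => rw [h.unique h', ih t']

theorem EvalList.exists {s : View V R L} {args : List (Operand V R L)}
    (h : ∀ a ∈ args, ∃ v, s.Eval a v) : ∃ vs, s.EvalList args vs := by
  induction args with
  | nil => exact ⟨[], .nil⟩
  | cons a args ih =>
    obtain ⟨v, hv⟩ := h a (by simp)
    obtain ⟨vs, hvs⟩ := ih fun b hb => h b (by simp [hb])
    exact ⟨v :: vs, .cons hv hvs⟩

/-- The labelled address given by operands in a view. -/
def EvalAddr [Lattice L] [OrderBot L] (M : Machine V Op) (s : View V R L)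
    (args : List (Operand V R L)) (a : LVal V L) : Prop :=
  ∃ vs, s.EvalList args vs ∧ a = ⟨M.addr (vs.map LVal.val), joinLabels vs⟩

/-- The truth value of a branch condition in a view, with its label. -/
def EvalCond [Lattice L] [OrderBot L] (M : Machine V Op) (s : View V R L) (o : Op)
    (args : List (Operand V R L)) (b : Bool) (l : L) : Prop :=
  ∃ vs, s.EvalList args vs ∧ b = M.evalCond o (vs.map LVal.val) ∧ l = joinLabels vs

section
variable [Lattice L] [OrderBot L] {M : Machine V Op} {s s' : View V R L}
  {args : List (Operand V R L)}

theorem EvalAddr.mono (h : s.Le s') {a} (e : s.EvalAddr M args a) : s'.EvalAddr M args a :=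
  let ⟨vs, hvs, ha⟩ := e; ⟨vs, hvs.mono h, ha⟩

theorem EvalCond.mono (h : s.Le s') {o b l} (e : s.EvalCond M o args b l) :
    s'.EvalCond M o args b l :=
  let ⟨vs, hvs, ha⟩ := e; ⟨vs, hvs.mono h, ha⟩

theorem EvalAddr.unique {a a'} (e : s.EvalAddr M args a) (e' : s.EvalAddr M args a') :
    a = a' := by
  obtain ⟨vs, hvs, rfl⟩ := e
  obtain ⟨ws, hws, rfl⟩ := e'
  rw [hvs.unique hws]

theorem EvalCond.unique {o b l b' l'} (e : s.EvalCond M o args b l)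
    (e' : s.EvalCond M o args b' l') : b = b' ∧ l = l' := by
  obtain ⟨vs, hvs, rfl, rfl⟩ := e
  obtain ⟨ws, hws, rfl, rfl⟩ := e'
  rw [hvs.unique hws]
  exact ⟨rfl, rfl⟩

end

end View

/-! ### Buffers given by lists -/

namespace Buffer

/-- The buffer that holds the entries of a list at consecutive indices. -/
def ofList (base : ℕ) (l : List (Transient V R Op L)) : Buffer V R Op L :=
  fun i => if base ≤ i then l[i - base]? else none

/-- The buffer holds the entries of `l` from index `base` on; an empty buffer starts at index `1`,
which makes `base + l.length` the next index in all cases. -/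
structure IsList (buf : Buffer V R Op L) (base : ℕ) (l : List (Transient V R Op L)) : Prop where
  eq : buf = ofList base l
  pos : 1 ≤ base
  nil : l = [] → base = 1

variable {buf : Buffer V R Op L} {base : ℕ} {l l₁ l₂ : List (Transient V R Op L)}
  {t : Transient V R Op L}

theorem ofList_some {i : ℕ} (h : ofList base l i = some t) :
    ∃ l₁ l₂, l = l₁ ++ t :: l₂ ∧ i = base + l₁.length := by
  unfold ofList at h
  split_ifs at h with hi
  obtain ⟨hlt, rfl⟩ := List.getElem?_eq_some_iff.1 h
  refine ⟨l.take (i - base), l.drop (i - base + 1), ?_, ?_⟩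
  · simp
  · simp; omega

theorem ofList_append_cons : ofList base (l₁ ++ t :: l₂) (base + l₁.length) = some t := by
  simp [ofList]

theorem ofList_lt {i : ℕ} (h : i < base) : ofList base l i = none := by
  simp [ofList, not_le.2 h]

theorem ofList_ge {i : ℕ} (h : base + l.length ≤ i) : ofList base l i = none := by
  simp only [ofList]
  split_ifs
  · simp; omega
  · rfl

theorem ofList_ne_none {i : ℕ} : ofList base l i ≠ none ↔ base ≤ i ∧ i < base + l.length := by
  constructor
  · intro h
    by_contra hc
    rcases lt_or_ge i base with h1 | h1
    · exact h (ofList_lt h1)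
    · exact h (ofList_ge (by omega))
  · rintro ⟨h1, h2⟩
    simp only [ofList, h1, if_true]
    simp; omega

theorem ofList_append_left {i : ℕ} (h : i < base + l₁.length) :
    ofList base (l₁ ++ l₂) i = ofList base l₁ i := by
  simp only [ofList]
  split_ifs
  · exact List.getElem?_append_left (by omega)
  · rfl

theorem dom_ofList : (ofList base l).dom = Set.Ico base (base + l.length) := by
  ext i
  simp only [dom, Set.mem_ofPred_eq, ofList_ne_none, Set.mem_Ico]

theorem size_ofList : (ofList base l).size = l.length := by
  rw [size, dom_ofList, ← Finset.coe_Ico, Set.ncard_coe_finset]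
  simp

theorem minIdx_ofList_cons : (ofList base (t :: l)).minIdx = base := by
  rw [minIdx, dom_ofList]
  exact csInf_Ico (by simp)

theorem IsList.size (h : buf.IsList base l) : buf.size = l.length := by
  rw [h.eq, size_ofList]

theorem IsList.fresh (h : buf.IsList base l) : buf.fresh = base + l.length := by
  rw [Buffer.fresh, maxIdx, h.eq, dom_ofList]
  rcases l.eq_nil_or_concat with rfl | ⟨l', t, rfl⟩
  · simp [h.nil rfl]
  · have : Set.Ico base (base + (l' ++ [t]).length) = Set.Icc base (base + l'.length) := by
      ext i; simp; omega
    rw [List.concat_eq_append, this, csSup_Icc (by omega)]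
    simp; omega

theorem IsList.min_eq (h : buf.IsList base l) (ht : buf buf.minIdx = some t) :
    buf.minIdx = base ∧ ∃ l', l = t :: l' := by
  obtain ⟨rfl, hp, -⟩ := h
  cases l with
  | nil => simp [ofList] at ht
  | cons t' l' =>
    rw [minIdx_ofList_cons] at ht ⊢
    simp [ofList] at ht
    exact ⟨rfl, l', by rw [ht]⟩

theorem IsList.exists_split {i : ℕ} (h : buf.IsList base l) (ht : buf i = some t) :
    ∃ l₁ l₂, l = l₁ ++ t :: l₂ ∧ i = base + l₁.length := by
  rw [h.eq] at ht
  exact ofList_some ht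

theorem IsList.push (h : buf.IsList base l) (t : Transient V R Op L) :
    IsList (update buf buf.fresh t) base (l ++ [t]) := by
  refine ⟨?_, h.pos, by simp⟩
  rw [h.fresh, h.eq]
  funext i
  rcases lt_trichotomy i (base + l.length) with hi | rfl | hi
  · rw [update_of_ne _ _ hi.ne, ofList_append_left hi]
  · rw [update_same, ofList_append_cons]
  · rw [update_of_ne _ _ hi.ne', ofList_ge hi.le, ofList_ge (by simp; omega)]

theorem IsList.set (h : buf.IsList base (l₁ ++ t :: l₂)) (t' : Transient V R Op L) :
    IsList (update buf (base + l₁.length) t') base (l₁ ++ t' :: l₂) := by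
  refine ⟨?_, h.pos, by simp⟩
  rw [h.eq]
  funext i
  by_cases hi : i = base + l₁.length
  · rw [hi, update_same, ofList_append_cons]
  · rw [update_of_ne _ _ hi]
    simp only [ofList]
    split_ifs
    · rw [List.getElem?_append, List.getElem?_append]
      split_ifs
      · rfl
      · obtain ⟨m, hm⟩ : ∃ m, i - base - l₁.length = m + 1 :=
          ⟨i - base - l₁.length - 1, by omega⟩
        rw [hm]; simp
    · rfl

theorem IsList.below_eq (h : buf.IsList base (l₁ ++ l₂)) :
    buf.below (base + l₁.length) = ofList base l₁ := by
  rw [h.eq]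
  funext i
  simp only [below]
  split_ifs with hi
  · exact ofList_append_left hi
  · exact (ofList_ge (by omega)).symm

theorem IsList.truncate_set (h : buf.IsList base (l₁ ++ t :: l₂)) (t' : Transient V R Op L) :
    IsList (update (buf.below (base + l₁.length)) (base + l₁.length) t') base (l₁ ++ [t']) := by
  refine ⟨?_, h.pos, by simp⟩
  rw [h.below_eq]
  funext i
  rcases lt_trichotomy i (base + l₁.length) with hi | rfl | hi
  · rw [update_of_ne _ _ hi.ne, ofList_append_left hi]
  · rw [update_same, ofList_append_cons]
  · rw [update_of_ne _ _ hi.ne', ofList_ge hi.le, ofList_ge (by simp; omega)]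

/-- The new base is existential because numbering restarts at `1` once the last entry is gone. -/
theorem IsList.tail (h : buf.IsList base (t :: l)) :
    ∃ base', (buf.above buf.minIdx).IsList base' l := by
  have hab : buf.above buf.minIdx = ofList (base + 1) l := by
    rw [h.eq, minIdx_ofList_cons]
    funext i
    simp only [above, ofList]
    rcases lt_or_ge base i with hi | hi
    · obtain ⟨m, rfl⟩ := Nat.exists_eq_add_of_lt hi
      have h1 : base + m + 1 - base = m + 1 := by omega
      have h2 : base + m + 1 - (base + 1) = m := by omega
      simp [h1, h2]; intros; omega
    · rw [if_neg (by omega), if_neg (by omega)]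
  cases l with
  | nil => exact ⟨1, by rw [hab]; funext i; simp [ofList], le_rfl, fun _ => rfl⟩
  | cons t' l' => exact ⟨base + 1, hab, by omega, by simp⟩

end Buffer

/-! ### Operand resolution in terms of views -/

namespace Config

/-- The registers and the memory of a configuration. -/
def view (C : Config V R Op L) : View V R L := ⟨C.reg, C.mem⟩

variable {C : Config V R Op L} {i : ℕ} {r : R} {v : LVal V L} {t : Transient V R Op L}

theorem resolvesReg_succ_of_dest (ht : C.buf i = some t) (hr : t.dest = some r) :
    C.ResolvesReg (i + 1) r v ↔ t.result = some v := by
  constructor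
  · rintro (@⟨j, t', _, hj, ht', hr', hlast, hv⟩ | ⟨hnone, hv⟩)
    · rcases Nat.lt_succ_iff_lt_or_eq.1 hj with hj | rfl
      · exact absurd ⟨t, ht, hr⟩ (hlast i hj (Nat.lt_succ_self i))
      · rw [ht] at ht'
        cases ht'
        exact hv
    · exact absurd ⟨t, ht, hr⟩ (hnone i (Nat.lt_succ_self i))
  · intro hv
    exact .pending (Nat.lt_succ_self i) ht hr (fun k h1 h2 => by omega) hv

theorem resolvesReg_succ_of_not_assigns (h : ¬ C.buf.Assigns i r) :
    C.ResolvesReg (i + 1) r v ↔ C.ResolvesReg i r v := by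
  constructor
  · rintro (@⟨j, t', _, hj, ht', hr', hlast, hv⟩ | ⟨hnone, hv⟩)
    · rcases Nat.lt_succ_iff_lt_or_eq.1 hj with hj | rfl
      · exact .pending hj ht' hr' (fun k h1 h2 => hlast k h1 (by omega)) hv
      · exact absurd ⟨t', ht', hr'⟩ h
    · exact .regfile (fun j hj => hnone j (by omega)) hv
  · rintro (@⟨j, t', _, hj, ht', hr', hlast, hv⟩ | ⟨hnone, hv⟩)
    · refine .pending (by omega) ht' hr' (fun k h1 h2 => ?_) hv
      rcases Nat.lt_succ_iff_lt_or_eq.1 h2 with h2 | rfl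
      · exact hlast k h1 h2
      · exact h
    · refine .regfile (fun j hj => ?_) hv
      rcases Nat.lt_succ_iff_lt_or_eq.1 hj with hj | rfl
      · exact hnone j hj
      · exact h

end Config

theorem View.apply_reg_of_dest (s : View V R L) {t : Transient V R Op L} {r : R}
    (h : t.dest = some r) : (s.apply t).reg r = t.result := by
  cases t <;> simp_all [Transient.dest, Transient.result, View.apply, assign_same]

theorem View.apply_reg_of_ne (s : View V R L) {t : Transient V R Op L} {r : R}
    (h : t.dest ≠ some r) : (s.apply t).reg r = s.reg r := by
  cases t <;> first
    | rfl
    | exact assign_of_ne _ _ fun e => h (by simp [Transient.dest, e])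

namespace Config

variable {C : Config V R Op L} {base : ℕ} {l₁ l₂ : List (Transient V R Op L)}

/-- The latest assignment decides, which is what a left fold of assignments computes. A pending
assignment writes `none`, so undefinedness agrees too. -/
theorem resolvesReg_iff (h : C.buf = .ofList base (l₁ ++ l₂)) {r : R} {v : LVal V L} :
    C.ResolvesReg (base + l₁.length) r v ↔ (C.view.applyAll l₁).reg r = some v := by
  induction l₁ using List.reverseRecOn generalizing l₂ with
  | nil =>
    have hn : ∀ j < base, C.buf j = none := fun j hj => by rw [h, Buffer.ofList_lt hj]
    constructor
    · rintro (@⟨j, t', _, hj, ht', hr', hlast, hv⟩ | ⟨hnone, hv⟩)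
      · rw [hn j hj] at ht'; cases ht'
      · exact hv
    · intro hv
      refine .regfile (fun j hj => ?_) hv
      rintro ⟨t, ht, -⟩
      rw [hn j hj] at ht; cases ht
  | append_singleton l₁ t ih =>
    have ht : C.buf (base + l₁.length) = some t := by
      rw [h, List.append_assoc]
      exact Buffer.ofList_append_cons
    rw [View.applyAll_concat, List.length_append, List.length_singleton, ← add_assoc]
    by_cases hr : t.dest = some r
    · rw [resolvesReg_succ_of_dest ht hr, View.apply_reg_of_dest _ hr]
    · rw [View.apply_reg_of_ne _ hr, resolvesReg_succ_of_not_assigns,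
        ih (l₂ := t :: l₂) (by simpa using h)]
      rintro ⟨t', ht', hr'⟩
      rw [ht] at ht'
      cases ht'
      exact hr hr'

theorem resolves_iff (h : C.buf = .ofList base (l₁ ++ l₂)) {a : Operand V R L} {v : LVal V L} :
    C.Resolves (base + l₁.length) a v ↔ (C.view.applyAll l₁).Eval a v := by
  constructor
  · rintro (h' | _)
    · exact (resolvesReg_iff h).1 h'
    · rfl
  · intro e
    cases a with
    | reg r => exact .reg ((resolvesReg_iff h).2 e)
    | imm w => cases e; exact .imm _

theorem resolvesList_iff (h : C.buf = .ofList base (l₁ ++ l₂)) {args : List (Operand V R L)}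
    {vs : List (LVal V L)} :
    C.ResolvesList (base + l₁.length) args vs ↔ (C.view.applyAll l₁).EvalList args vs :=
  ⟨List.Forall₂.imp fun _ _ => (resolves_iff h).1, List.Forall₂.imp fun _ _ => (resolves_iff h).2⟩

theorem resolvesAddr_iff [Lattice L] [OrderBot L] {M : Machine V Op}
    (h : C.buf = .ofList base (l₁ ++ l₂)) {args : List (Operand V R L)} {a : LVal V L} :
    C.ResolvesAddr M (base + l₁.length) args a ↔ (C.view.applyAll l₁).EvalAddr M args a := by
  simp only [ResolvesAddr, View.EvalAddr, resolvesList_iff h]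

theorem resolvesCond_iff [Lattice L] [OrderBot L] {M : Machine V Op}
    (h : C.buf = .ofList base (l₁ ++ l₂)) {o : Op} {args : List (Operand V R L)} {b : Bool}
    {l : L} :
    C.ResolvesCond M (base + l₁.length) o args b l ↔
      (C.view.applyAll l₁).EvalCond M o args b l := by
  simp only [ResolvesCond, View.EvalCond, resolvesList_iff h]

end Config

/-! ### Memory reads in terms of views -/

theorem View.apply_mem_of_ne (s : View V R L) {t : Transient V R Op L} {a : V}
    (h : ∀ src l, t ≠ .storeAt src ⟨a, l⟩) : (s.apply t).mem a = s.mem a := by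
  cases t with
  | storeAt src b =>
    refine assign_of_ne _ _ ?_
    rintro rfl
    exact h src b.label rfl
  | _ => rfl

namespace Config

/-- A load from `a` at index `i` gets `v`, from the store at index `j` or from memory. -/
def ReadsFrom (C : Config V R Op L) (i : ℕ) (a : V) (v : LVal V L) : Option ℕ → Prop
  | none => (∀ j < i, ¬ C.buf.StoresTo j a) ∧ C.mem a = some v
  | some j => j < i ∧ (∃ la, C.buf j = some (.storeAt (.imm v) ⟨a, la⟩)) ∧
      ∀ k, j < k → k < i → ¬ C.buf.StoresTo k a

variable {C : Config V R Op L} {base : ℕ} {l₁ l₂ : List (Transient V R Op L)}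

theorem readsFrom_succ {i : ℕ} {a : V} {v : LVal V L} {j : Option ℕ}
    (h : ¬ C.buf.StoresTo i a) : C.ReadsFrom (i + 1) a v j ↔ C.ReadsFrom i a v j := by
  cases j with
  | none =>
    refine and_congr_left fun _ => ⟨fun h' j hj => h' j (by omega), fun h' j hj => ?_⟩
    rcases Nat.lt_succ_iff_lt_or_eq.1 hj with hj | rfl
    · exact h' j hj
    · exact h
  | some j =>
    constructor
    · rintro ⟨h1, ⟨la, h2⟩, h3⟩
      rcases Nat.lt_succ_iff_lt_or_eq.1 h1 with h1 | rfl
      · exact ⟨h1, ⟨la, h2⟩, fun k hk hk' => h3 k hk (by omega)⟩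
      · exact absurd ⟨_, _, h2⟩ h
    · rintro ⟨h1, h2, h3⟩
      refine ⟨by omega, h2, fun k hk hk' => ?_⟩
      rcases Nat.lt_succ_iff_lt_or_eq.1 hk' with hk' | rfl
      · exact h3 k hk hk'
      · exact h

/-- The view forgets which store supplied the value, hence the existential over the source. -/
theorem readsFrom_iff (h : C.buf = .ofList base (l₁ ++ l₂)) {a : V} {v : LVal V L} :
    (∃ j, C.ReadsFrom (base + l₁.length) a v j) ↔ (C.view.applyAll l₁).mem a = some v := by
  induction l₁ using List.reverseRecOn generalizing l₂ with
  | nil =>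
    have hn : ∀ j < base, C.buf j = none := fun j hj => by rw [h, Buffer.ofList_lt hj]
    constructor
    · rintro ⟨_ | j, hj⟩
      · exact hj.2
      · obtain ⟨h1, ⟨la, h2⟩, -⟩ := hj
        rw [hn j h1] at h2; cases h2
    · intro hv
      refine ⟨none, fun j hj => ?_, hv⟩
      rintro ⟨src, l, e⟩
      rw [hn j hj] at e; cases e
  | append_singleton l₁ t ih =>
    have ht : C.buf (base + l₁.length) = some t := by
      rw [h, List.append_assoc]
      exact Buffer.ofList_append_cons
    rw [View.applyAll_concat, List.length_append, List.length_singleton, ← add_assoc]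
    by_cases hs : C.buf.StoresTo (base + l₁.length) a
    · obtain ⟨src, l, hs'⟩ := hs
      rw [ht] at hs'
      cases hs'
      simp only [View.apply, assign_same]
      constructor
      · rintro ⟨_ | j, hj⟩
        · exact absurd ⟨_, _, ht⟩ (hj.1 _ (Nat.lt_succ_self _))
        · obtain ⟨h1, ⟨la, h2⟩, h3⟩ := hj
          rcases Nat.lt_succ_iff_lt_or_eq.1 h1 with h1 | rfl
          · exact absurd ⟨_, _, ht⟩ (h3 _ h1 (Nat.lt_succ_self _))
          · rw [ht] at h2
            cases h2
            rfl
      · intro hv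
        cases src with
        | reg r => cases hv
        | imm w =>
          cases hv
          exact ⟨some (base + l₁.length), Nat.lt_succ_self _, ⟨l, ht⟩, fun k _ _ => by omega⟩
    · simp only [readsFrom_succ hs]
      rw [ih (l₂ := t :: l₂) (by simpa using h), View.apply_mem_of_ne]
      rintro src l rfl
      exact hs ⟨src, l, ht⟩

end Config


/-! ### Histories: justified sequences of transient instructions -/

/-- `src'` is the data operand `src`, possibly resolved in the view. -/
def View.SourceOf (s : View V R L) (src src' : Operand V R L) : Prop :=
  src' = src ∨ ∃ v, src' = .imm v ∧ s.Eval src v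

theorem View.SourceOf.mono {s s' : View V R L} (h : s.Le s') {src src' : Operand V R L}
    (e : s.SourceOf src src') : s'.SourceOf src src' :=
  e.imp_right fun ⟨v, hv, e⟩ => ⟨v, hv, e.mono h⟩

theorem View.SourceOf.resolve {s : View V R L} {src src' : Operand V R L} {v : LVal V L}
    (h : s.SourceOf src src') (e : s.Eval src' v) : s.SourceOf src (.imm v) := by
  rcases h with rfl | ⟨w, rfl, hw⟩
  · exact .inr ⟨v, rfl, e⟩
  · cases e
    exact .inr ⟨_, rfl, hw⟩

theorem View.Eval.of_reg_eq {s s' : View V R L} (h : s.reg = s'.reg) {a : Operand V R L} {v}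
    (e : s.Eval a v) : s'.Eval a v := by
  cases a with
  | reg r => exact (congrFun h r).symm.trans e
  | imm w => exact e

theorem View.apply_reg_eq {s s' : View V R L} (h : s.reg = s'.reg) (t : Transient V R Op L) :
    (s.apply t).reg = (s'.apply t).reg := by
  cases t <;> simp [View.apply, h]

/-- Resolving a pending assignment replaces `none`, so nothing defined is lost. -/
theorem View.apply_le_of_reg {s : View V R L} {t : Transient V R Op L} {r : R} {f}
    (h : s.apply t = { s with reg := assign s.reg r none }) :
    (s.apply t).Le { s with reg := assign s.reg r f } := by
  rw [h]
  exact ⟨assign_le (fun _ _ e => e) _ (by simp), fun _ _ e => e⟩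

theorem Config.ReadsFrom.eq_some {C : Config V R Op L} {base : ℕ}
    {l₁ l₂ : List (Transient V R Op L)} (h : C.buf = .ofList base (l₁ ++ l₂)) {a : V}
    {v : LVal V L} {j : Option ℕ} (hr : C.ReadsFrom (base + l₁.length) a v j) :
    (C.view.applyAll l₁).mem a = some v := (readsFrom_iff h).1 ⟨j, hr⟩

/-! ### Forwarding links from loads to stores -/

namespace Buffer

/-- A load is only forwarded from an older store to the same address, as long as that store is in
the buffer. -/
def Linked (buf : Buffer V R Op L) : Prop :=
  ∀ k r v j a nk, buf k = some (.loaded r v (some j) a nk) →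
    j < k ∧ ∀ t, buf j = some t → ∃ src la, t = .storeAt src ⟨a, la⟩

variable {buf buf' : Buffer V R Op L}

/-- Only sources still present are constrained, so discarding entries is harmless. -/
theorem Linked.mono (h : buf.Linked) (hle : ∀ i t, buf' i = some t → buf i = some t) :
    buf'.Linked := fun k r v j a nk hk =>
  let ⟨h1, h2⟩ := h k r v j a nk (hle _ _ hk)
  ⟨h1, fun t ht => h2 t (hle _ _ ht)⟩

theorem Linked.below (h : buf.Linked) (i : ℕ) : (buf.below i).Linked :=
  h.mono fun j t => by unfold Buffer.below; split_ifs <;> simp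

theorem Linked.above (h : buf.Linked) (i : ℕ) : (buf.above i).Linked :=
  h.mono fun j t => by unfold Buffer.above; split_ifs <;> simp

/-- Stores keep their address and a newly forwarded load brings its own link. The hypothesis `hnew`
confines writes into an empty slot to the end of the buffer, where no younger load can name that
slot as its source. -/
theorem Linked.update (h : buf.Linked) {i : ℕ} {t : Transient V R Op L}
    (hst : ∀ src a, buf i = some (.storeAt src a) → ∃ src', t = .storeAt src' a)
    (hld : ∀ r v j a nk, t = .loaded r v (some j) a nk →
      j < i ∧ ∃ src la, buf j = some (.storeAt src ⟨a, la⟩))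
    (hnew : buf i = none → ∀ k > i, buf k = none) :
    Linked (SpecCT.update buf i t) := by
  intro k r v j a nk hk
  by_cases hki : k = i
  · subst hki
    rw [update_same] at hk
    obtain ⟨hj, src, la, hsrc⟩ := hld r v j a nk (Option.some.inj hk)
    refine ⟨hj, fun t' ht' => ?_⟩
    rw [update_of_ne _ _ hj.ne, hsrc] at ht'
    exact ⟨src, la, (Option.some.inj ht').symm⟩
  · rw [update_of_ne _ _ hki] at hk
    obtain ⟨hj, hl⟩ := h k r v j a nk hk
    refine ⟨hj, fun t' ht' => ?_⟩
    by_cases hji : j = i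
    · subst hji
      rw [update_same] at ht'
      cases ht'
      cases hb : buf j with
      | none => rw [hnew hb k hj] at hk; cases hk
      | some t₀ =>
        obtain ⟨src, la, rfl⟩ := hl t₀ hb
        obtain ⟨src', rfl⟩ := hst _ _ hb
        exact ⟨src', la, rfl⟩
    · rw [update_of_ne _ _ hji] at ht'
      exact hl t' ht'

end Buffer

/-! ### Justified entries and histories -/

section

variable [Lattice L] [OrderBot L] {M : Machine V Op} {prog : V → Option (Instr V R Op L)}

/-- `Justified M prog s pc t pc'`: in the view `s`, the entry `t` is a correctly resolved or
unresolved transient form of the instruction at `pc`, after which execution goes on at `pc'`. -/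
inductive Justified (M : Machine V Op) (prog : V → Option (Instr V R Op L)) (s : View V R L) :
    V → Transient V R Op L → V → Prop
  | op {pc o r args next} (hp : prog pc = some (.op o r args next)) :
      Justified M prog s pc (.op o r args) next
  | val {pc o r args next vs} (hp : prog pc = some (.op o r args next))
      (hvs : s.EvalList args vs) :
      Justified M prog s pc (.val r ⟨M.evalOp o (vs.map LVal.val), joinLabels vs⟩) next
  | load {pc r args next} (hp : prog pc = some (.load r args next)) :
      Justified M prog s pc (.load r args pc) next
  -- The source `j` is unconstrained: views depend on the value alone, and `Buffer.Linked` keeps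
  -- track of sources.
  | loaded {pc r args next a v j} (hp : prog pc = some (.load r args next))
      (ha : s.EvalAddr M args a) (hv : s.mem a.val = some v) :
      Justified M prog s pc (.loaded r v j a.val pc) next
  | store {pc src src' args next} (hp : prog pc = some (.store src args next))
      (hs : s.SourceOf src src') : Justified M prog s pc (.store src' args) next
  | storeAt {pc src src' args next a} (hp : prog pc = some (.store src args next))
      (hs : s.SourceOf src src') (ha : s.EvalAddr M args a) :
      Justified M prog s pc (.storeAt src' a) next
  | br {pc o args nTrue nFalse} (b : Bool) (hp : prog pc = some (.br o args nTrue nFalse)) :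
      Justified M prog s pc (.br o args (branchTarget nTrue nFalse b) nTrue nFalse)
        (branchTarget nTrue nFalse b)
  | jump {pc o args nTrue nFalse b l} (hp : prog pc = some (.br o args nTrue nFalse))
      (hb : s.EvalCond M o args b l) :
      Justified M prog s pc (.jump (branchTarget nTrue nFalse b)) (branchTarget nTrue nFalse b)

/-- `Hist M prog s pc l pc'`: the entries of `l`, starting in view `s` at `pc`, are successively
justified and lead to `pc'`. -/
inductive Hist (M : Machine V Op) (prog : V → Option (Instr V R Op L)) :
    View V R L → V → List (Transient V R Op L) → V → Prop
  | nil (s pc) : Hist M prog s pc [] pc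
  | cons {s pc t pc₁ l pc₂} (h : Justified M prog s pc t pc₁)
      (hl : Hist M prog (s.apply t) pc₁ l pc₂) : Hist M prog s pc (t :: l) pc₂

/-- Justification asserts only that certain lookups succeed with given values, so defining more
registers and cells cannot break it. -/
theorem Justified.mono {s s' : View V R L} (h : s.Le s') {pc t pc'}
    (j : Justified M prog s pc t pc') : Justified M prog s' pc t pc' := by
  cases j with
  | op hp => exact .op hp
  | val hp hvs => exact .val hp (hvs.mono h)
  | load hp => exact .load hp
  | loaded hp ha hv => exact .loaded hp (ha.mono h) (h.2 _ _ hv)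
  | store hp hs => exact .store hp (hs.mono h)
  | storeAt hp hs ha => exact .storeAt hp (hs.mono h) (ha.mono h)
  | br b hp => exact .br b hp
  | jump hp hb => exact .jump hp (hb.mono h)

theorem Hist.mono {s s' : View V R L} (h : s.Le s') {pc l pc'}
    (hl : Hist M prog s pc l pc') : Hist M prog s' pc l pc' := by
  induction hl generalizing s' with
  | nil => exact .nil _ _
  | cons j _ ih => exact .cons (j.mono h) (ih (h.apply _))

theorem Hist.append_iff {s : View V R L} {pc l₁ l₂ pc'} :
    Hist M prog s pc (l₁ ++ l₂) pc' ↔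
      ∃ pc₁, Hist M prog s pc l₁ pc₁ ∧ Hist M prog (s.applyAll l₁) pc₁ l₂ pc' := by
  induction l₁ generalizing s pc with
  | nil =>
    constructor
    · intro h; exact ⟨pc, .nil _ _, h⟩
    · rintro ⟨_, h, h'⟩; cases h; exact h'
  | cons t l ih =>
    constructor
    · intro h
      cases h with
      | cons j h =>
        obtain ⟨pc₁, h1, h2⟩ := ih.1 h
        exact ⟨pc₁, .cons j h1, h2⟩
    · rintro ⟨pc₁, h, h'⟩
      cases h with
      | cons j h => exact .cons j (ih.2 ⟨pc₁, h, h'⟩)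

theorem Hist.cons_iff {s : View V R L} {pc t l pc'} :
    Hist M prog s pc (t :: l) pc' ↔
      ∃ pc₁, Justified M prog s pc t pc₁ ∧ Hist M prog (s.apply t) pc₁ l pc' := by
  constructor
  · intro h; cases h with | cons j h => exact ⟨_, j, h⟩
  · rintro ⟨_, j, h⟩; exact .cons j h

theorem Hist.singleton {s : View V R L} {pc t pc'} (h : Justified M prog s pc t pc') :
    Hist M prog s pc [t] pc' := .cons h (.nil _ _)

/-- A history remains justified if the memory changes at one address, provided that every
resolved load from that address comes after a store to it. -/
theorem Hist.of_shielded {s s' : View V R L} {a : V} {pc l pc'} (h : Hist M prog s pc l pc')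
    (hreg : s.reg = s'.reg) (hmem : ∀ x, x ≠ a → s.mem x = s'.mem x)
    (hl : ∀ l₁ l₂ r v j nk, l = l₁ ++ .loaded r v j a nk :: l₂ →
      ∃ src la, Transient.storeAt src ⟨a, la⟩ ∈ l₁) :
    Hist M prog s' pc l pc' := by
  induction h generalizing s' with
  | nil => exact .nil _ _
  | @cons s pc t pc₁ l pc₂ j h ih =>
    have hlist {args : List (Operand V R L)} {vs} (e : s.EvalList args vs) :
        s'.EvalList args vs := List.Forall₂.imp (fun _ _ e => e.of_reg_eq hreg) e
    have haddr {args : List (Operand V R L)} {b} (e : s.EvalAddr M args b) :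
        s'.EvalAddr M args b := let ⟨vs, e, hb⟩ := e; ⟨vs, hlist e, hb⟩
    have hsrc {src src' : Operand V R L} (e : s.SourceOf src src') : s'.SourceOf src src' :=
      e.imp_right fun ⟨v, hv, e⟩ => ⟨v, hv, e.of_reg_eq hreg⟩
    have j' : Justified M prog s' pc t pc₁ := by
      cases j with
      | op hp => exact .op hp
      | val hp hvs => exact .val hp (hlist hvs)
      | load hp => exact .load hp
      | @loaded _ _ _ b _ _ hp ha hv =>
        refine .loaded hp (haddr ha) ?_
        rw [← hmem, hv]
        -- An unshielded load from `a` is impossible, as no entry precedes this one.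
        rintro rfl
        obtain ⟨_, _, hm⟩ := hl [] l _ _ _ _ rfl
        cases hm
      | store hp hs => exact .store hp (hsrc hs)
      | storeAt hp hs ha => exact .storeAt hp (hsrc hs) (haddr ha)
      | br b hp => exact .br b hp
      | jump hp hb => exact .jump hp (let ⟨vs, e, hb⟩ := hb; ⟨vs, hlist e, hb⟩)
    refine .cons j' ?_
    have hreg' := View.apply_reg_eq hreg t
    by_cases hst : ∃ src la, t = .storeAt src ⟨a, la⟩
    · obtain ⟨src, la, rfl⟩ := hst
      -- Past a store to `a` the two views coincide, so the rest of the history is unchanged.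
      convert h using 1
      simp only [View.apply, View.mk.injEq]
      refine ⟨hreg.symm, funext fun x => ?_⟩
      by_cases hx : x = a
      · subst hx; simp [assign_same]
      · rw [assign_of_ne _ _ hx, assign_of_ne _ _ hx, hmem x hx]
    · refine ih hreg' (fun x hx => ?_) fun l₁ l₂ r v j nk e => ?_
      · cases t <;> first
          | exact hmem x hx
          | (simp only [View.apply, assign]; split_ifs <;> [rfl; exact hmem x hx])
      · obtain ⟨src, la, hm⟩ := hl (t :: l₁) l₂ r v j nk (by rw [e]; rfl)
        rcases List.mem_cons.1 hm with rfl | hm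
        · exact absurd ⟨src, la, rfl⟩ hst
        · exact ⟨src, la, hm⟩

/-! ### The invariant of arbitrary executions -/

/-- What connects an execution from `C` with the configuration `C'` reached: the entries `past`
have been retired, the buffer holds the entries `l`, and all of them are justified. -/
structure Trail (M : Machine V Op) (C C' : Config V R Op L) (past : List (Transient V R Op L))
    (pc₁ : V) (base : ℕ) (l : List (Transient V R Op L)) : Prop where
  prog : C'.prog = C.prog
  isList : C'.buf.IsList base l
  retired : Hist M C.prog C.view C.pc past pc₁
  full : ∀ t ∈ past, t.FullyResolved
  view : C.view.applyAll past = C'.view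
  pending : Hist M C.prog C'.view pc₁ l C'.pc
  linked : C'.buf.Linked

namespace Trail

variable {C C' : Config V R Op L} {past l l₁ l₂ : List (Transient V R Op L)} {pc₁ : V} {base : ℕ}
  {t t' : Transient V R Op L}

theorem push (h : Trail M C C' past pc₁ base l) {pc' : V}
    (hj : Justified M C.prog (C'.view.applyAll l) C'.pc t pc')
    (ht : ∀ r v j a nk, t ≠ .loaded r v j a nk) :
    Trail M C { C' with pc := pc', buf := update C'.buf C'.buf.fresh t } past pc₁ base
      (l ++ [t]) where
  prog := h.prog
  isList := h.isList.push t
  retired := h.retired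
  full := h.full
  view := h.view
  pending := Hist.append_iff.2 ⟨_, h.pending, .singleton hj⟩
  linked := by
    have hn : ∀ k ≥ C'.buf.fresh, C'.buf k = none := fun k hk => by
      rw [h.isList.fresh] at hk
      rw [h.isList.eq, Buffer.ofList_ge hk]
    refine h.linked.update (fun src a e => ?_) (fun r v j a nk e => absurd e (ht _ _ _ _ _))
      fun _ k hk => hn k hk.le
    rw [hn _ le_rfl] at e
    cases e

theorem linked_set (h : Trail M C C' past pc₁ base (l₁ ++ t :: l₂))
    (hst : ∀ src a, t = .storeAt src a → ∃ src', t' = .storeAt src' a)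
    (hld : ∀ r v j a nk, t' = .loaded r v (some j) a nk →
      j < base + l₁.length ∧ ∃ src la, C'.buf j = some (.storeAt src ⟨a, la⟩)) :
    Buffer.Linked (update C'.buf (base + l₁.length) t') := by
  have hb : C'.buf (base + l₁.length) = some t := by
    rw [h.isList.eq, Buffer.ofList_append_cons]
  refine h.linked.update (fun src a e => ?_) hld fun e => ?_
  · rw [hb] at e
    exact hst src a (Option.some.inj e)
  · rw [hb] at e
    cases e

/-- Covers the resolutions that only make the view more defined; younger entries stay justified by
`Hist.mono`. A late store address may violate `hle` and needs `resolve_addr`. -/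
theorem set (h : Trail M C C' past pc₁ base (l₁ ++ t :: l₂))
    (hj : ∀ pc pc', Justified M C.prog (C'.view.applyAll l₁) pc t pc' →
      Justified M C.prog (C'.view.applyAll l₁) pc t' pc')
    (hle : ((C'.view.applyAll l₁).apply t).Le ((C'.view.applyAll l₁).apply t'))
    (hst : ∀ src a, t = .storeAt src a → ∃ src', t' = .storeAt src' a)
    (hld : ∀ r v j a nk, t' = .loaded r v (some j) a nk →
      j < base + l₁.length ∧ ∃ src la, C'.buf j = some (.storeAt src ⟨a, la⟩)) :
    Trail M C { C' with buf := update C'.buf (base + l₁.length) t' } past pc₁ base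
      (l₁ ++ t' :: l₂) where
  prog := h.prog
  isList := h.isList.set t'
  retired := h.retired
  full := h.full
  view := h.view
  pending := by
    obtain ⟨pc₂, h1, h2⟩ := Hist.append_iff.1 h.pending
    obtain ⟨pc₃, h3, h4⟩ := Hist.cons_iff.1 h2
    exact Hist.append_iff.2 ⟨pc₂, h1, .cons (hj _ _ h3) (h4.mono hle)⟩
  linked := h.linked_set hst hld

theorem mispredict (h : Trail M C C' past pc₁ base (l₁ ++ t :: l₂)) {n' : V}
    (hj : ∀ pc pc', Justified M C.prog (C'.view.applyAll l₁) pc t pc' →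
      Justified M C.prog (C'.view.applyAll l₁) pc t' n')
    (ht : ∀ r v j a nk, t' ≠ .loaded r v j a nk) :
    Trail M C { C' with
        pc := n'
        buf := update (C'.buf.below (base + l₁.length)) (base + l₁.length) t' } past pc₁ base
      (l₁ ++ [t']) where
  prog := h.prog
  isList := h.isList.truncate_set t'
  retired := h.retired
  full := h.full
  view := h.view
  pending := by
    obtain ⟨pc₂, h1, h2⟩ := Hist.append_iff.1 h.pending
    obtain ⟨pc₃, h3, h4⟩ := Hist.cons_iff.1 h2
    exact Hist.append_iff.2 ⟨pc₂, h1, .singleton (hj _ _ h3)⟩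
  linked := by
    refine (h.linked.below _).update (fun src a e => ?_)
      (fun r v j a nk e => absurd e (ht _ _ _ _ _)) fun _ k hk => ?_
    · simp [Buffer.below] at e
    · simp only [Buffer.below]
      exact if_neg (by omega)

/-- The justification of the discarded entry is kept because, for a load, it identifies the recorded
program point with `pc₂`, where a rollback resumes. An empty `l₁` is excluded since an empty buffer
must have base `1`. -/
theorem truncate (h : Trail M C C' past pc₁ base (l₁ ++ t :: l₂)) (hl : l₁ ≠ []) :
    ∃ pc₂ pc₃, Justified M C.prog (C'.view.applyAll l₁) pc₂ t pc₃ ∧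
      Trail M C { C' with pc := pc₂, buf := C'.buf.below (base + l₁.length) } past pc₁ base
        l₁ := by
  obtain ⟨pc₂, h1, h2⟩ := Hist.append_iff.1 h.pending
  obtain ⟨pc₃, h3, -⟩ := Hist.cons_iff.1 h2
  exact ⟨pc₂, pc₃, h3,
    { prog := h.prog
      isList := ⟨h.isList.below_eq, h.isList.pos, fun e => absurd e hl⟩
      retired := h.retired
      full := h.full
      view := h.view
      pending := h1
      linked := h.linked.below _ }⟩

theorem retire (h : Trail M C C' past pc₁ base (t :: l)) (ht : t.FullyResolved)
    {C'' : Config V R Op L} (hprog : C''.prog = C'.prog) (hpc : C''.pc = C'.pc)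
    (hview : C''.view = C'.view.apply t) (hbuf : C''.buf = C'.buf.above C'.buf.minIdx) :
    ∃ past' pc₂ base' l', Trail M C C'' past' pc₂ base' l' := by
  obtain ⟨base', hl⟩ := h.isList.tail
  obtain ⟨pc₂, h1, h2⟩ := Hist.cons_iff.1 h.pending
  refine ⟨past ++ [t], pc₂, base', l, ?_⟩
  exact
    { prog := hprog.trans h.prog
      isList := hbuf ▸ hl
      retired := Hist.append_iff.2 ⟨_, h.retired, .singleton (h.view ▸ h1)⟩
      full := by
        intro t' ht'
        rcases List.mem_append.1 ht' with ht' | ht'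
        · exact h.full t' ht'
        · rw [List.mem_singleton.1 ht']; exact ht
      view := by rw [View.applyAll_concat, h.view, hview]
      pending := by rw [hview, hpc]; exact h2
      linked := hbuf ▸ h.linked.above _ }

/-- The new address may replace defined memory values, so monotonicity does not apply. Without a
hazard, a younger load from this address was forwarded from an index not below that of the store. By
`Linked` the entry there stores to the same address, and it is not the present store, whose address
was unresolved. Thus a store in between shields the load, as `Hist.of_shielded` requires. -/
theorem resolve_addr {src : Operand V R L} {args a}
    (h : Trail M C C' past pc₁ base (l₁ ++ .store src args :: l₂))
    (ha : (C'.view.applyAll l₁).EvalAddr M args a)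
    (hok : ∀ k nk, ¬ C'.buf.HazardAt (base + l₁.length) a.val k nk) :
    Trail M C { C' with buf := update C'.buf (base + l₁.length) (.storeAt src a) } past pc₁ base
      (l₁ ++ .storeAt src a :: l₂) where
  prog := h.prog
  isList := h.isList.set _
  retired := h.retired
  full := h.full
  view := h.view
  linked := h.linked_set (by simp) (by simp)
  pending := by
    obtain ⟨pc₂, h1, h2⟩ := Hist.append_iff.1 h.pending
    obtain ⟨pc₃, h3, h4⟩ := Hist.cons_iff.1 h2
    refine Hist.append_iff.2 ⟨pc₂, h1, .cons (pc₁ := pc₃) ?_ ?_⟩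
    · cases h3 with
      | store hp hs => exact .storeAt hp hs ha
    · refine h4.of_shielded (a := a.val) rfl (fun x hx => (assign_of_ne _ _ hx).symm) ?_
      · rintro m₁ m₂ r v j nk rfl
        have hi : C'.buf (base + l₁.length) = some (.store src args) := by
          rw [h.isList.eq, Buffer.ofList_append_cons]
        have hk : C'.buf (base + (l₁ ++ .store src args :: m₁).length) =
            some (.loaded r v j a.val nk) := by
          rw [h.isList.eq, ← List.cons_append, ← List.append_assoc, Buffer.ofList_append_cons]
        have hnh := hok (base + (l₁ ++ .store src args :: m₁).length) nk
        simp only [Buffer.HazardAt, not_and, not_exists, not_or] at hnh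
        have hlt : base + l₁.length < base + (l₁ ++ .store src args :: m₁).length := by
          simp
        have := (hnh hlt r v j a.val hk).1 rfl
        push Not at this
        obtain ⟨j₀, rfl, hj₀⟩ := this
        obtain ⟨hjk, hjl⟩ := h.linked _ _ _ _ _ _ hk
        have hne : C'.buf j₀ ≠ none := by
          rw [h.isList.eq, Buffer.ofList_ne_none]
          simp only [List.length_append, List.length_cons] at hjk hj₀ ⊢
          omega
        obtain ⟨tj, htj⟩ := Option.ne_none_iff_exists'.1 hne
        obtain ⟨src', la, rfl⟩ := hjl tj htj
        have hji : j₀ ≠ base + l₁.length := by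
          rintro rfl
          rw [hi] at htj
          cases htj
        refine ⟨src', la, ?_⟩
        -- `q` is the position within `m₁` of the store that was forwarded.
        obtain ⟨q, rfl⟩ : ∃ q, j₀ = base + l₁.length + 1 + q :=
          ⟨j₀ - (base + l₁.length + 1), by omega⟩
        have hq : q < m₁.length := by
          simp only [List.length_append, List.length_cons] at hjk
          omega
        rw [h.isList.eq, Buffer.ofList, if_pos (by omega),
          show base + l₁.length + 1 + q - base = l₁.length + (q + 1) by omega,
          List.getElem?_append_right (by omega)] at htj
        simp only [Nat.add_sub_cancel_left, List.getElem?_cons_succ,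
          List.getElem?_append_left hq] at htj
        exact List.mem_of_getElem? htj

end Trail

variable {C C' : Config V R Op L}

theorem Trail.initial (hC : C.Initial) : Trail M C C [] C.pc 1 [] where
  prog := rfl
  isList := ⟨funext fun i => by rw [hC i]; simp [Buffer.ofList], le_rfl, fun _ => rfl⟩
  retired := .nil _ _
  full := by simp
  view := rfl
  pending := .nil _ _
  linked := fun k r v j a nk hk => by rw [hC k] at hk; cases hk

/-- A step extends the history, resolves an entry, cuts it back, or moves the boundary between
retired and buffered entries. Fences have no clause in `Justified`, hence `hfence`. -/
theorem Trail.step (hfence : ∀ m next, C.prog m ≠ some (.fence next))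
    {past pc₁ base l} (h : Trail M C C' past pc₁ base l) {d o C''} (hs : Step M C' d o C'') :
    ∃ past' pc₁' base' l', Trail M C C'' past' pc₁' base' l' := by
  cases hs with
  | op_fetch hp =>
    exact ⟨_, _, _, _, h.push (.op (h.prog ▸ hp)) (by simp)⟩
  | load_fetch hp =>
    exact ⟨_, _, _, _, h.push (.load (h.prog ▸ hp)) (by simp)⟩
  | store_fetch hp =>
    exact ⟨_, _, _, _, h.push (.store (h.prog ▸ hp) (.inl rfl)) (by simp)⟩
  | fence_fetch hp => exact absurd (h.prog ▸ hp) (hfence _ _)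
  | br_fetch b hp =>
    exact ⟨_, _, _, _, h.push (.br b (h.prog ▸ hp)) (by simp)⟩
  | op_execute hi hf hargs =>
    obtain ⟨l₁, l₂, rfl, rfl⟩ := h.isList.exists_split hi
    rw [Config.resolvesList_iff h.isList.eq] at hargs
    refine ⟨_, _, _, _, h.set ?_ (View.apply_le_of_reg rfl) (by simp) (by simp)⟩
    intro pc pc' hj
    cases hj with
    | op hp => exact .val hp hargs
  | br_execute_correct hi hf hargs hb =>
    obtain ⟨l₁, l₂, rfl, rfl⟩ := h.isList.exists_split hi
    rw [Config.resolvesCond_iff h.isList.eq] at hargs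
    refine ⟨_, _, _, _, h.set ?_ (.refl _) (by simp) (by simp)⟩
    intro pc pc' hj
    subst hb
    -- Guess and outcome may differ as Booleans when both targets coincide; only the target matters.
    generalize hn : branchTarget _ _ _ = n₀ at hj ⊢
    cases hj with
    | br b' hp => exact hn ▸ .jump hp hargs
  | br_execute_incorrect hi hf hargs hb =>
    obtain ⟨l₁, l₂, rfl, rfl⟩ := h.isList.exists_split hi
    rw [Config.resolvesCond_iff h.isList.eq] at hargs
    refine ⟨_, _, _, _, h.mispredict ?_ (by simp)⟩
    intro pc pc' hj
    cases hj with
    | br b' hp => exact .jump hp hargs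
  | @load_execute_nodep i r args n a v hi hf hargs hst hv =>
    obtain ⟨l₁, l₂, rfl, rfl⟩ := h.isList.exists_split hi
    rw [Config.resolvesAddr_iff h.isList.eq] at hargs
    have hm := Config.ReadsFrom.eq_some h.isList.eq (j := none) ⟨hst, hv⟩
    refine ⟨_, _, _, _, h.set ?_ (View.apply_le_of_reg rfl) (by simp) (by simp)⟩
    intro pc pc' hj
    cases hj with
    | load hp => exact .loaded hp hargs hm
  | @load_execute_forward i j r args n a v la hi hf hargs hj hst hlast =>
    obtain ⟨l₁, l₂, rfl, rfl⟩ := h.isList.exists_split hi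
    rw [Config.resolvesAddr_iff h.isList.eq] at hargs
    have hm := Config.ReadsFrom.eq_some h.isList.eq (j := some j) ⟨hj, ⟨_, hst⟩, hlast⟩
    refine ⟨_, _, _, _, h.set ?_ (View.apply_le_of_reg rfl) (by simp) ?_⟩
    · intro pc pc' hj
      cases hj with
      | load hp => exact .loaded hp hargs hm
    · intro r' v' j' a' nk' e
      cases e
      exact ⟨hj, _, _, hst⟩
  | store_execute_value hi hf hv =>
    obtain ⟨l₁, l₂, rfl, rfl⟩ := h.isList.exists_split hi
    rw [Config.resolves_iff h.isList.eq] at hv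
    refine ⟨_, _, _, _, h.set ?_ (.refl _) (by simp) (by simp)⟩
    intro pc pc' hj
    cases hj with
    | store hp hs => exact .store hp (hs.resolve hv)
  | @storeAt_execute_value i src a v hi hf hv =>
    obtain ⟨l₁, l₂, rfl, rfl⟩ := h.isList.exists_split hi
    rw [Config.resolves_iff h.isList.eq] at hv
    refine ⟨_, _, _, _, h.set ?_ ?_ (by simp) (by simp)⟩
    · intro pc pc' hj
      cases hj with
      | storeAt hp hs ha => exact .storeAt hp (hs.resolve hv) ha
    -- The cell is undefined if `src` is a register, and an immediate `src` already is the value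
    -- `v`.
    · refine ⟨fun _ _ e => e, assign_le (fun _ _ e => e) _ fun w e => ?_⟩
      cases src with
      | reg r => cases e
      | imm u => cases hv; exact e
  | store_execute_addr_ok hi hf hargs hok =>
    obtain ⟨l₁, l₂, rfl, rfl⟩ := h.isList.exists_split hi
    rw [Config.resolvesAddr_iff h.isList.eq] at hargs
    exact ⟨_, _, _, _, h.resolve_addr hargs hok⟩
  | @store_execute_addr_hazard i k src args a nk hi hf hargs hk hmin =>
    obtain ⟨l₁, l₂, rfl, rfl⟩ := h.isList.exists_split hi
    rw [Config.resolvesAddr_iff h.isList.eq] at hargs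
    obtain ⟨hik, r, v, j, ak, hkb, -⟩ := hk
    have hkb' := hkb
    rw [h.isList.eq] at hkb'
    obtain ⟨m₁, m₂, hm, hkm⟩ := Buffer.ofList_some hkb'
    obtain ⟨l₃, rfl⟩ : ∃ l₃, m₁ = l₁ ++ .store src args :: l₃ := by
      have hpre : l₁ ++ [.store src args] <+: m₁ := by
        refine List.prefix_of_prefix_length_le (l₃ := m₁ ++ .loaded r v j ak nk :: m₂) ?_
          (List.prefix_append _ _) (by simp; omega)
        rw [← hm]
        exact ⟨l₂, by simp⟩
      obtain ⟨l₃, rfl⟩ := hpre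
      exact ⟨l₃, by simp⟩
    -- The rollback amounts to a truncation at `k` followed by an address resolution, which is free
    -- of hazards because `k` is the least one.
    rw [hm] at h
    obtain ⟨pc₂, pc₃, hj, h'⟩ := h.truncate (by simp)
    rw [← hkm] at h'
    cases hj with
    | loaded hp ha hv =>
      refine ⟨_, _, _, _, h'.resolve_addr hargs fun k₁ n₁ hz => ?_⟩
      obtain ⟨h1, r', v', j', a', hb', h2⟩ := hz
      simp only [Buffer.below] at hb'
      split_ifs at hb' with hlt
      exact hmin k₁ hlt n₁ ⟨h1, r', v', j', a', hb', h2⟩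
  | value_retire hi =>
    obtain ⟨-, l', rfl⟩ := h.isList.min_eq hi
    exact h.retire trivial rfl rfl rfl rfl
  | load_retire hi =>
    obtain ⟨-, l', rfl⟩ := h.isList.min_eq hi
    exact h.retire trivial rfl rfl rfl rfl
  | store_retire hi =>
    obtain ⟨-, l', rfl⟩ := h.isList.min_eq hi
    exact h.retire trivial rfl rfl rfl rfl
  | jump_retire hi =>
    obtain ⟨-, l', rfl⟩ := h.isList.min_eq hi
    exact h.retire trivial rfl rfl rfl rfl
  | fence_retire hi =>
    obtain ⟨-, l', rfl⟩ := h.isList.min_eq hi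
    obtain ⟨_, j, -⟩ := Hist.cons_iff.1 h.pending
    cases j

theorem BoundedExec.exists_trail {n : ℕ} (hC : C.Initial)
    (hfence : ∀ m next, C.prog m ≠ some (.fence next)) {D O}
    (h : BoundedExec M n C D O C') : ∃ past pc₁ base l, Trail M C C' past pc₁ base l := by
  induction h with
  | nil => exact ⟨_, _, _, _, .initial hC⟩
  | snoc _ hs _ ih =>
    obtain ⟨_, _, _, _, h⟩ := ih
    exact h.step hfence hs

end

/-! ### Buffers that occur in tool schedules -/

/-- Transient instructions that occur between the steps of tool schedules: assignments are
resolved, stores with resolved address have resolved data, and there are no fences. -/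
def Transient.Ready : Transient V R Op L → Prop
  | .op _ _ _ => False
  | .load _ _ _ => False
  | .storeAt (.reg _) _ => False
  | .fence => False
  | _ => True

/-- Assignments in a ready buffer carry values, so an undefined register has no assignment at all:
the situation that `FaultFree` excludes. -/
theorem View.applyAll_reg_eq_none {s : View V R L} {l : List (Transient V R Op L)}
    (hl : ∀ t ∈ l, t.Ready) {r : R} (h : (s.applyAll l).reg r = none) :
    s.reg r = none ∧ ∀ t ∈ l, t.dest ≠ some r := by
  induction l using List.reverseRecOn with
  | nil => exact ⟨h, by simp⟩
  | append_singleton l t ih =>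
    rw [applyAll_concat] at h
    have ht := hl t (by simp)
    by_cases hd : t.dest = some r
    · rw [apply_reg_of_dest _ hd] at h
      cases t <;> simp_all [Transient.dest, Transient.result, Transient.Ready]
    · rw [apply_reg_of_ne _ hd] at h
      obtain ⟨h1, h2⟩ := ih (fun t ht => hl t (by simp [ht])) h
      refine ⟨h1, fun t' ht' => ?_⟩
      rcases List.mem_append.1 ht' with ht' | ht'
      · exact h2 t' ht'
      · rw [List.mem_singleton.1 ht']; exact hd

theorem View.applyAll_mem_eq_none {s : View V R L} {l : List (Transient V R Op L)}
    (hl : ∀ t ∈ l, t.Ready) {a : V} (h : (s.applyAll l).mem a = none) :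
    s.mem a = none ∧ ∀ t ∈ l, ∀ src la, t ≠ .storeAt src ⟨a, la⟩ := by
  induction l using List.reverseRecOn with
  | nil => exact ⟨h, by simp⟩
  | append_singleton l t ih =>
    rw [applyAll_concat] at h
    have ht := hl t (by simp)
    by_cases hd : ∃ src la, t = .storeAt src ⟨a, la⟩
    · obtain ⟨src, la, rfl⟩ := hd
      cases src with
      | reg r => exact ht.elim
      | imm v => simp [View.apply, assign_same, Operand.data] at h
    · push Not at hd
      rw [apply_mem_of_ne _ hd] at h
      obtain ⟨h1, h2⟩ := ih (fun t ht => hl t (by simp [ht])) h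
      refine ⟨h1, fun t' ht' => ?_⟩
      rcases List.mem_append.1 ht' with ht' | ht'
      · exact h2 t' ht'
      · rw [List.mem_singleton.1 ht']; exact hd

theorem Buffer.IsList.noFence {buf : Buffer V R Op L} {base : ℕ} {l₁ l₂}
    (h : buf.IsList base (l₁ ++ l₂)) (hl : ∀ t ∈ l₁, t.Ready) :
    buf.NoFence (base + l₁.length) := by
  intro j hj e
  rw [h.eq, ofList_append_left hj] at e
  obtain ⟨m₁, m₂, rfl, -⟩ := ofList_some e
  exact hl .fence (by simp)

theorem Buffer.IsList.apply_length {buf : Buffer V R Op L} {base : ℕ} {l₁ t l₂}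
    (h : buf.IsList base (l₁ ++ t :: l₂)) : buf (base + l₁.length) = some t := by
  rw [h.eq, ofList_append_cons]

theorem forall_ready_concat {l : List (Transient V R Op L)} {t : Transient V R Op L}
    (hl : ∀ t ∈ l, t.Ready) (ht : t.Ready) :
    ∀ t' ∈ l ++ [t], t'.Ready := by
  intro t' ht'
  rcases List.mem_append.1 ht' with ht' | ht'
  · exact hl t' ht'
  · rw [List.mem_singleton.1 ht']; exact ht

theorem TraceHasLabel.append_right {O O' : List (Obs V L)} {x : L} (h : TraceHasLabel O' x) :
    TraceHasLabel (O ++ O') x :=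
  let ⟨o, ho, hx⟩ := h; ⟨o, List.mem_append_right _ ho, hx⟩

/-- Data already resolved in the smaller view agrees with what the larger view yields, since
evaluation is monotone and single-valued. -/
theorem View.SourceOf.data_le {s s' : View V R L} {src src' : Operand V R L} {v : LVal V L}
    (h : s.SourceOf src src') (hle : s.Le s') (hv : s'.Eval src v) (w : LVal V L)
    (hw : src'.data = some w) : (Operand.imm v : Operand V R L).data = some w := by
  cases src' with
  | reg r => cases hw
  | imm u =>
    cases hw
    rcases h with rfl | ⟨_, e, hu⟩
    · exact congrArg some hv.symm
    · cases e
      exact congrArg some (hv.unique (hu.mono hle))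

variable [Lattice L] [OrderBot L] {M : Machine V Op} {n : ℕ} {C T : Config V R Op L}
  {D : List Directive} {O : List (Obs V L)} {base : ℕ} {l : List (Transient V R Op L)}
  {t : Transient V R Op L}

theorem BoundedExec.exec (h : BoundedExec M n C D O T) : Exec M C D O T := by
  induction h with
  | nil => exact .nil
  | snoc _ hs _ ih => exact .snoc ih hs

/-! ### Progress of eager execution -/

namespace FaultFree

/-- Older assignments are all resolved, so only a hole in the register map could block the operand,
and that would be a fault. -/
theorem exists_eval (hf : FaultFree M n C) (h : BoundedExec M n C D O T)
    (hb : T.buf.IsList base (l ++ [t])) (hl : ∀ t ∈ l, t.Ready) {a : Operand V R L}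
    (ha : a ∈ t.operands) : ∃ v, (T.view.applyAll l).Eval a v := by
  cases a with
  | imm v => exact ⟨v, rfl⟩
  | reg r =>
    refine Option.ne_none_iff_exists'.1 fun hn => ?_
    obtain ⟨h1, h2⟩ := View.applyAll_reg_eq_none hl hn
    refine (hf D O T h _ t hb.apply_length).1 r ha (fun j hj => ?_) h1
    rintro ⟨t', ht', hd⟩
    rw [hb.eq, Buffer.ofList_append_left hj] at ht'
    obtain ⟨m₁, m₂, rfl, -⟩ := Buffer.ofList_some ht'
    exact h2 t' (by simp) hd

theorem exists_evalList (hf : FaultFree M n C) (h : BoundedExec M n C D O T)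
    (hb : T.buf.IsList base (l ++ [t])) (hl : ∀ t ∈ l, t.Ready) {args : List (Operand V R L)}
    (ha : ∀ a ∈ args, a ∈ t.operands) : ∃ vs, (T.view.applyAll l).EvalList args vs :=
  View.EvalList.exists fun a h' => hf.exists_eval h hb hl (ha a h')

theorem exists_mem (hf : FaultFree M n C) (h : BoundedExec M n C D O T) {r args m}
    (hb : T.buf.IsList base (l ++ [.load r args m])) (hl : ∀ t ∈ l, t.Ready) {a : LVal V L}
    (ha : (T.view.applyAll l).EvalAddr M args a) :
    ∃ v, (T.view.applyAll l).mem a.val = some v := by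
  refine Option.ne_none_iff_exists'.1 fun hn => ?_
  obtain ⟨h1, h2⟩ := View.applyAll_mem_eq_none hl hn
  refine (hf D O T h _ _ hb.apply_length).2 r args m a rfl
    ((Config.resolvesAddr_iff hb.eq).2 ha) (fun j hj => ?_) h1
  rintro ⟨src, la, ht'⟩
  rw [hb.eq, Buffer.ofList_append_left hj] at ht'
  obtain ⟨m₁, m₂, rfl, -⟩ := Buffer.ofList_some ht'
  exact h2 _ (by simp) src la rfl

end FaultFree

/-! ### Executions of tool schedules -/

/-- A tool schedule `D` leads to the configuration `T`, whose buffer holds the entries `l`. -/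
structure ToolRun (M : Machine V Op) (n : ℕ) (C : Config V R Op L) (D : List Directive)
    (O : List (Obs V L)) (T : Config V R Op L) (base : ℕ) (l : List (Transient V R Op L)) :
    Prop where
  schedule : D ∈ ToolSchedules M C n
  exec : BoundedExec M n C D O T
  prog : T.prog = C.prog
  isList : T.buf.IsList base l
  ready : ∀ t ∈ l, t.Ready

theorem BoundedExec.step (h : BoundedExec M n C D O T) {d o T'} (hs : Step M T d o T')
    (hl : T'.buf.IsList base l) (hn : l.length ≤ n) : BoundedExec M n C (D ++ [d]) (O ++ o) T' :=
  .snoc h hs (hl.size ▸ hn)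

namespace ToolRun

theorem op (h : ToolRun M n C D O T base l) (hf : FaultFree M n C) (hn : l.length < n)
    {o r args next} (hp : C.prog T.pc = some (.op o r args next)) :
    ∃ vs D' O' T', (T.view.applyAll l).EvalList args vs ∧
      ToolRun M n C D' O' T' base
        (l ++ [.val r ⟨M.evalOp o (vs.map LVal.val), joinLabels vs⟩]) ∧
      T'.view = T.view ∧ T'.pc = next := by
  rw [← h.prog] at hp
  have hl₁ := h.isList.push (.op o r args)
  have e₁ := h.exec.step (.op_fetch hp) hl₁ (by simpa using hn)
  obtain ⟨vs, hvs⟩ := hf.exists_evalList e₁ hl₁ h.ready (fun _ ha => ha)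
  have hl₂ := hl₁.set (.val r ⟨M.evalOp o (vs.map LVal.val), joinLabels vs⟩)
  have e₂ := e₁.step (.op_execute hl₁.apply_length (hl₁.noFence h.ready)
    ((Config.resolvesList_iff hl₁.eq).2 hvs)) hl₂ (by simpa using hn)
  refine ⟨vs, _, _, _, hvs, ⟨?_, e₂, h.prog, hl₂, forall_ready_concat h.ready trivial⟩, rfl, rfl⟩
  rw [List.append_assoc, ← h.isList.fresh]
  exact .op h.schedule h.exec.exec (h.isList.size ▸ hn) hp

theorem load (h : ToolRun M n C D O T base l) (hf : FaultFree M n C) (hn : l.length < n)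
    {r args next} (hp : C.prog T.pc = some (.load r args next)) :
    ∃ a v j D' O' T', (T.view.applyAll l).EvalAddr M args a ∧
      (T.view.applyAll l).mem a.val = some v ∧
      ToolRun M n C D' O' T' base (l ++ [.loaded r v j a.val T.pc]) ∧
      T'.view = T.view ∧ T'.pc = next ∧ TraceHasLabel O' a.label := by
  rw [← h.prog] at hp
  have hl₁ := h.isList.push (.load r args T.pc)
  have e₁ := h.exec.step (.load_fetch hp) hl₁ (by simpa using hn)
  obtain ⟨vs, hvs⟩ := hf.exists_evalList e₁ hl₁ h.ready (fun _ ha => ha)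
  have ha : (T.view.applyAll l).EvalAddr M args
    ⟨M.addr (vs.map LVal.val), joinLabels vs⟩ := ⟨vs, hvs, rfl⟩
  generalize (⟨M.addr (vs.map LVal.val), joinLabels vs⟩ : LVal V L) = a at ha
  obtain ⟨v, hv⟩ := hf.exists_mem e₁ hl₁ h.ready ha
  obtain ⟨j, hj⟩ := (Config.readsFrom_iff hl₁.eq).2 hv
  have hl₂ := hl₁.set (.loaded r v j a.val T.pc)
  have hra := (Config.resolvesAddr_iff (C := { T with
    pc := next, buf := update T.buf T.buf.fresh (.load r args T.pc) }) hl₁.eq).2 ha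
  have hD : D ++ [.fetch] ++ [.execute (base + l.length)] ∈ ToolSchedules M C n := by
    rw [List.append_assoc, ← h.isList.fresh]
    exact .load h.schedule h.exec.exec (h.isList.size ▸ hn) hp
  -- Reading from memory and forwarding reveal the same labelled address.
  cases j with
  | none =>
    have e₂ := e₁.step (.load_execute_nodep hl₁.apply_length (hl₁.noFence h.ready) hra hj.1 hj.2)
      hl₂ (by simpa using hn)
    exact ⟨a, v, none, _, _, _, ha, hv,
      ⟨hD, e₂, h.prog, hl₂, forall_ready_concat h.ready trivial⟩, rfl, rfl,
      .append_right ⟨_, List.mem_singleton_self _, rfl⟩⟩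
  | some j =>
    obtain ⟨hjl, ⟨la, hst⟩, hlast⟩ := hj
    have e₂ := e₁.step (.load_execute_forward hl₁.apply_length (hl₁.noFence h.ready) hra hjl hst
      hlast) hl₂ (by simpa using hn)
    exact ⟨a, v, some j, _, _, _, ha, hv,
      ⟨hD, e₂, h.prog, hl₂, forall_ready_concat h.ready trivial⟩, rfl, rfl,
      .append_right ⟨_, List.mem_singleton_self _, rfl⟩⟩

theorem store (h : ToolRun M n C D O T base l) (hf : FaultFree M n C) (hn : l.length < n)
    {src args next} (hp : C.prog T.pc = some (.store src args next)) :
    ∃ v a, (T.view.applyAll l).Eval src v ∧ (T.view.applyAll l).EvalAddr M args a ∧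
      (∃ D' O' T', ToolRun M n C D' O' T' base (l ++ [.store (.imm v) args]) ∧
        T'.view = T.view ∧ T'.pc = next) ∧
      ∃ D' O' T', ToolRun M n C D' O' T' base (l ++ [.storeAt (.imm v) a]) ∧
        T'.view = T.view ∧ T'.pc = next ∧ TraceHasLabel O' a.label := by
  rw [← h.prog] at hp
  have hl₁ := h.isList.push (.store src args)
  have e₁ := h.exec.step (.store_fetch hp) hl₁ (by simpa using hn)
  obtain ⟨v, hv⟩ := hf.exists_eval e₁ hl₁ h.ready (a := src) (by simp [Transient.operands])
  obtain ⟨vs, hvs⟩ := hf.exists_evalList e₁ hl₁ h.ready (args := args)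
    (fun a ha => by simp [Transient.operands, ha])
  have ha : (T.view.applyAll l).EvalAddr M args
    ⟨M.addr (vs.map LVal.val), joinLabels vs⟩ := ⟨vs, hvs, rfl⟩
  generalize (⟨M.addr (vs.map LVal.val), joinLabels vs⟩ : LVal V L) = a at ha
  have hl₂ := hl₁.set (.store (.imm v) args)
  have e₂ := e₁.step (.store_execute_value hl₁.apply_length (hl₁.noFence h.ready)
    ((Config.resolves_iff hl₁.eq).2 hv)) hl₂ (by simpa using hn)
  have hl₃ := hl₂.set (.storeAt (.imm v) a)
  -- The newest entry has no younger loads, so resolving its address meets no hazard.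
  have e₃ := e₂.step (.store_execute_addr_ok hl₂.apply_length (hl₂.noFence h.ready)
    ((Config.resolvesAddr_iff hl₂.eq).2 ha) (by
      rintro k nk ⟨hk, r, w, j, ak, hb, -⟩
      replace hb := (congrFun hl₂.eq k).symm.trans hb
      rw [Buffer.ofList_ge (by simp; omega)] at hb
      cases hb)) hl₃ (by simpa using hn)
  refine ⟨v, a, hv, ha,
    ⟨_, _, _, ⟨?_, e₂, h.prog, hl₂, forall_ready_concat h.ready trivial⟩, rfl, rfl⟩,
    ⟨_, _, _, ⟨?_, e₃, h.prog, hl₃, forall_ready_concat h.ready trivial⟩, rfl, rfl,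
      .append_right ⟨_, List.mem_singleton_self _, rfl⟩⟩⟩
  · rw [List.append_assoc, ← h.isList.fresh]
    exact .store_unresolved h.schedule h.exec.exec (h.isList.size ▸ hn) hp
  · rw [List.append_assoc, List.append_assoc, ← h.isList.fresh]
    exact .store_resolved h.schedule h.exec.exec (h.isList.size ▸ hn) hp

/-- The right guess is executed and reveals the label of the condition; the wrong one stays pending,
so that the tool can go on along the wrong path. -/
theorem br (h : ToolRun M n C D O T base l) (hf : FaultFree M n C) (hn : l.length < n)
    {o args nTrue nFalse} (hp : C.prog T.pc = some (.br o args nTrue nFalse)) :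
    ∃ b x, (T.view.applyAll l).EvalCond M o args b x ∧
      (∃ D' O' T', ToolRun M n C D' O' T' base (l ++ [.jump (branchTarget nTrue nFalse b)]) ∧
        T'.view = T.view ∧ T'.pc = branchTarget nTrue nFalse b ∧ TraceHasLabel O' x) ∧
      ∃ D' O' T', ToolRun M n C D' O' T' base
          (l ++ [.br o args (branchTarget nTrue nFalse !b) nTrue nFalse]) ∧
        T'.view = T.view ∧ T'.pc = branchTarget nTrue nFalse !b := by
  rw [← h.prog] at hp
  have hl₁ (b) := h.isList.push (.br o args (branchTarget nTrue nFalse b) nTrue nFalse)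
  have e₁ (b) := h.exec.step (.br_fetch b hp) (hl₁ b) (by simpa using hn)
  -- The operands do not depend on the guess; `true` is an arbitrary choice.
  obtain ⟨vs, hvs⟩ := hf.exists_evalList (e₁ true) (hl₁ true) h.ready (fun _ ha => ha)
  have hc : (T.view.applyAll l).EvalCond M o args _ _ := ⟨vs, hvs, rfl, rfl⟩
  generalize M.evalCond o (vs.map LVal.val) = b, joinLabels vs = x at hc
  have hrc : T.ResolvesCond M T.buf.fresh o args b x := by
    rw [h.isList.fresh]
    exact (Config.resolvesCond_iff (l₂ := []) (by simpa using h.isList.eq)).2 hc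
  have hl₂ := (hl₁ b).set (.jump (branchTarget nTrue nFalse b))
  have e₂ := (e₁ b).step (.br_execute_correct (hl₁ b).apply_length ((hl₁ b).noFence h.ready)
    ((Config.resolvesCond_iff (hl₁ b).eq).2 hc) rfl) hl₂ (by simpa using hn)
  refine ⟨b, x, hc,
    ⟨_, _, _, ⟨?_, e₂, h.prog, hl₂, forall_ready_concat h.ready trivial⟩, rfl, rfl,
      .append_right ⟨_, List.mem_singleton_self _, rfl⟩⟩,
    ⟨_, _, _, ⟨?_, e₁ !b, h.prog, hl₁ !b, forall_ready_concat h.ready trivial⟩, rfl, rfl⟩⟩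
  · rw [List.append_assoc, ← h.isList.fresh]
    exact .br_correct h.schedule h.exec.exec (h.isList.size ▸ hn) hp hrc
  · exact .br_incorrect h.schedule h.exec.exec (h.isList.size ▸ hn) hp hrc

/-- Only the rule for fully resolved entries is used: a store that is to be retired gets its address
right after its fetch. -/
theorem retire (h : ToolRun M n C D O T base (t :: l)) (hn : l.length + 1 = n)
    (ht : t.FullyResolved) :
    ∃ D' O' T' base', ToolRun M n C D' O' T' base' l ∧ T'.view = T.view.apply t ∧
      T'.pc = T.pc := by
  obtain ⟨base', hl⟩ := h.isList.tail
  have hi : T.buf T.buf.minIdx = some t := by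
    rw [h.isList.eq, Buffer.minIdx_ofList_cons]
    exact Buffer.ofList_append_cons (l₁ := [])
  have hD : D ++ [.retire] ∈ ToolSchedules M C n :=
    .retire h.schedule h.exec.exec (h.isList.size.trans hn) hi ht
  have hr : ∀ t' ∈ l, t'.Ready := fun t' ht' => h.ready t' (List.mem_cons_of_mem _ ht')
  have hln : l.length ≤ n := by omega
  cases t with
  | val r v => exact ⟨_, _, _, base', ⟨hD, h.exec.step (.value_retire hi) hl hln, h.prog, hl, hr⟩,
      rfl, rfl⟩
  | loaded r v j a m =>
    exact ⟨_, _, _, base', ⟨hD, h.exec.step (.load_retire hi) hl hln, h.prog, hl, hr⟩, rfl, rfl⟩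
  | storeAt src a =>
    cases src with
    | reg r => exact ht.elim
    | imm v =>
      exact ⟨_, _, _, base', ⟨hD, h.exec.step (.store_retire hi) hl hln, h.prog, hl, hr⟩, rfl, rfl⟩
  | jump n₀ =>
    exact ⟨_, _, _, base', ⟨hD, h.exec.step (.jump_retire hi) hl hln, h.prog, hl, hr⟩, rfl, rfl⟩
  | fence => exact (h.ready _ List.mem_cons_self).elim
  | _ => exact ht.elim

end ToolRun

/-! ### Simulation of histories by tool schedules -/

/-- The tool may resolve what `e` leaves pending, with two exceptions. An unresolved store address
stays so, since resolving it would change what younger loads read; a wrong guess stays pending,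
since executing it would leave the path to `pc'`. The last conjunct later permits retirement. -/
theorem ToolRun.simulate (h : ToolRun M n C D O T base l) (hf : FaultFree M n C)
    (hn : l.length < n) {s : View V R L} {e : Transient V R Op L} {pc' : V}
    (hj : Justified M C.prog s T.pc e pc') (hle : s.Le (T.view.applyAll l)) :
    ∃ D' O' T' t', ToolRun M n C D' O' T' base (l ++ [t']) ∧ T'.view = T.view ∧ T'.pc = pc' ∧
      (s.apply e).Le ((T.view.applyAll l).apply t') ∧ (e.FullyResolved → t'.FullyResolved) := by
  generalize hpc : T.pc = pc at hj
  cases hj with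
  | op hp =>
    subst hpc
    obtain ⟨vs, D', O', T', hvs, h', hv, hpc⟩ := h.op hf hn hp
    exact ⟨D', O', T', _, h', hv, hpc, ⟨assign_le hle.1 _ (by simp), hle.2⟩, fun _ => trivial⟩
  | val hp hvs =>
    subst hpc
    obtain ⟨vs, D', O', T', hvs', h', hv, hpc⟩ := h.op hf hn hp
    cases (hvs.mono hle).unique hvs'
    exact ⟨D', O', T', _, h', hv, hpc, hle.apply _, fun _ => trivial⟩
  | load hp =>
    subst hpc
    obtain ⟨a, v, j, D', O', T', ha, hm, h', hv, hpc, -⟩ := h.load hf hn hp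
    exact ⟨D', O', T', _, h', hv, hpc, ⟨assign_le hle.1 _ (by simp), hle.2⟩, fun _ => trivial⟩
  | loaded hp ha hm =>
    subst hpc
    obtain ⟨a, v, j, D', O', T', ha', hm', h', hv, hpc, -⟩ := h.load hf hn hp
    cases (ha.mono hle).unique ha'
    cases (hle.2 _ _ hm).symm.trans hm'
    exact ⟨D', O', T', _, h', hv, hpc, hle.apply _, fun _ => trivial⟩
  | store hp hs =>
    subst hpc
    obtain ⟨v, a, hv, ha, ⟨D', O', T', h', hview, hpc⟩, -⟩ := h.store hf hn hp
    exact ⟨D', O', T', _, h', hview, hpc, hle, False.elim⟩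
  | storeAt hp hs ha =>
    subst hpc
    obtain ⟨v, a, hv, ha', -, D', O', T', h', hview, hpc, -⟩ := h.store hf hn hp
    cases (ha.mono hle).unique ha'
    exact ⟨D', O', T', _, h', hview, hpc, ⟨hle.1, assign_le hle.2 _ (hs.data_le hle hv)⟩,
      fun _ => trivial⟩
  | br b hp =>
    subst hpc
    obtain ⟨b', x, hb, ⟨D', O', T', h', hview, hpc, -⟩, D'', O'', T'', h'', hview', hpc'⟩ :=
      h.br hf hn hp
    -- A pending branch guessed right is executed by the tool, one guessed wrong remains pending.
    by_cases hbb : b = b'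
    · subst hbb
      exact ⟨D', O', T', _, h', hview, hpc, hle, False.elim⟩
    · replace hbb := Bool.eq_not_iff.2 hbb
      subst hbb
      exact ⟨D'', O'', T'', _, h'', hview', hpc', hle, False.elim⟩
  | jump hp hb =>
    subst hpc
    obtain ⟨b', x, hb', ⟨D', O', T', h', hview, hpc, -⟩, -⟩ := h.br hf hn hp
    obtain ⟨rfl, -⟩ := (hb.mono hle).unique hb'
    exact ⟨D', O', T', _, h', hview, hpc, hle, fun _ => trivial⟩

/-- A history in which all entries but the last `n - 1` are fully resolved can be followed by a
tool schedule that keeps room for a further instruction. -/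
theorem exists_toolRun (hC : C.Initial) (hf : FaultFree M n C) (hn : 0 < n)
    {E : List (Transient V R Op L)} {pc : V} (hE : Hist M C.prog C.view C.pc E pc)
    (hfull : ∀ E₀ e E₁, E = E₀ ++ e :: E₁ → n ≤ E₁.length + 1 → e.FullyResolved) :
    ∃ D O T base l E₀ E₁, ToolRun M n C D O T base l ∧ l.length < n ∧ T.pc = pc ∧
      (C.view.applyAll E).Le (T.view.applyAll l) ∧ E = E₀ ++ E₁ ∧
      List.Forall₂ (fun e t => e.FullyResolved → t.FullyResolved) E₁ l := by
  induction E using List.reverseRecOn generalizing pc with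
  | nil =>
    cases hE
    have hl := (Trail.initial (M := M) hC).isList
    exact ⟨[], [], C, 1, [], [], [],
      ⟨.nil, .nil (by rw [hl.size]; exact Nat.zero_le _), rfl, hl, by simp⟩, hn, rfl, .refl _,
      rfl, .nil⟩
  | append_singleton E e ih =>
    obtain ⟨pc₁, hE', he⟩ := Hist.append_iff.1 hE
    obtain ⟨_, hj, hnil⟩ := Hist.cons_iff.1 he
    cases hnil
    -- Appending an entry only lengthens `E₁`, so the hypothesis on `E` passes to the prefix.
    obtain ⟨D, O, T, base, l, E₀, E₁, h, hl, rfl, hle, rfl, hall⟩ := ih hE' fun E₀ e' E₁ hE hn =>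
      hfull E₀ e' (E₁ ++ [e]) (by simp [hE]) (by simp; omega)
    obtain ⟨D', O', T', t, h', hview, hpc, hle', hres⟩ := h.simulate hf hl hj hle
    rw [← View.applyAll_concat, ← View.applyAll_concat, ← hview] at hle'
    have hall' : List.Forall₂ (fun e t => e.FullyResolved → t.FullyResolved) (E₁ ++ [e])
        (l ++ [t]) := List.rel_append hall (.cons hres .nil)
    rcases Nat.lt_or_ge (l ++ [t]).length n with hlt | hge
    · exact ⟨D', O', T', base, _, E₀, E₁ ++ [e], h', hlt, hpc, hle', by simp, hall'⟩
    · have hlen : (l ++ [t]).length = n := by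
        simp only [List.length_append, List.length_singleton] at hge ⊢
        omega
      rw [List.append_assoc] at hfull hle' ⊢
      generalize E₁ ++ [e] = E₂, l ++ [t] = l' at hall' h' hlen hle' hfull ⊢
      cases hall' with
      | nil => simp at hlen; omega
      | @cons e' t' E₂ l' hres' hall' =>
        -- `E₂` has `n - 1` entries, so `hfull` applies to `e'`, the counterpart of the oldest
        -- buffer entry.
        have hfe := hfull E₀ e' E₂ rfl (by rw [hall'.length_eq, ← hlen]; simp)
        obtain ⟨D'', O'', T'', base'', h'', hview', hpc'⟩ := h'.retire hlen (hres' hfe)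
        refine ⟨D'', O'', T'', base'', l', E₀ ++ [e'], E₂, h'', ?_, hpc'.trans hpc, ?_, by simp,
          hall'⟩
        · rw [← hlen]; simp
        · rw [hview']; exact hle'

/-! ### Leaks -/

/-- The instruction at `pc`, executed in the view `s`, makes an observation with the label `x`. -/
inductive Leaks (M : Machine V Op) (prog : V → Option (Instr V R Op L)) (s : View V R L) (pc : V)
    (x : L) : Prop
  | load {r args next a} (hp : prog pc = some (.load r args next)) (ha : s.EvalAddr M args a)
      (hx : a.label = x)
  | store {src args next a} (hp : prog pc = some (.store src args next))
      (ha : s.EvalAddr M args a) (hx : a.label = x)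
  | br {o args nTrue nFalse b} (hp : prog pc = some (.br o args nTrue nFalse))
      (hb : s.EvalCond M o args b x)

/-- Executed at once in a view above `s`, the instruction has the same address or condition, hence
the same label. A store takes the schedule that resolves its address, a branch the right guess. -/
theorem ToolRun.leak (h : ToolRun M n C D O T base l) (hf : FaultFree M n C)
    (hn : l.length < n) {s : View V R L} {x : L} (hx : Leaks M C.prog s T.pc x)
    (hle : s.Le (T.view.applyAll l)) :
    ∃ Dt ∈ ToolSchedules M C n, ∃ Ot Ct, Exec M C Dt Ot Ct ∧ TraceHasLabel Ot x := by
  cases hx with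
  | load hp ha hx =>
    obtain ⟨a, v, j, D', O', T', ha', -, h', -, -, hO⟩ := h.load hf hn hp
    cases (ha.mono hle).unique ha'
    exact ⟨D', h'.schedule, O', T', h'.exec.exec, hx ▸ hO⟩
  | store hp ha hx =>
    obtain ⟨v, a, -, ha', -, D', O', T', h', -, -, hO⟩ := h.store hf hn hp
    cases (ha.mono hle).unique ha'
    exact ⟨D', h'.schedule, O', T', h'.exec.exec, hx ▸ hO⟩
  | br hp hb =>
    obtain ⟨b', x', hb', ⟨D', O', T', h', -, -, hO⟩, -⟩ := h.br hf hn hp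
    obtain ⟨-, rfl⟩ := (hb.mono hle).unique hb'
    exact ⟨D', h'.schedule, O', T', h'.exec.exec, hO⟩

/-- An observation with the label `x` comes from an entry of the buffer whose instruction leaks
`x`. -/
theorem Trail.exists_leaks {C' C'' : Config V R Op L} {past : List (Transient V R Op L)} {pc₁ : V}
    (h : Trail M C C' past pc₁ base l) {d o x} (hs : Step M C' d o C'') (hx : TraceHasLabel o x) :
    ∃ l₁ t l₂, l = l₁ ++ t :: l₂ ∧ ∀ pc pc', Justified M C.prog (C'.view.applyAll l₁) pc t pc' →
      Leaks M C.prog (C'.view.applyAll l₁) pc x := by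
  obtain ⟨ob, hob, hx⟩ := hx
  cases hs with
  | br_execute_correct hi hf hargs hb =>
    obtain ⟨l₁, l₂, rfl, rfl⟩ := h.isList.exists_split hi
    rw [Config.resolvesCond_iff h.isList.eq] at hargs
    refine ⟨l₁, _, l₂, rfl, fun pc pc' hj => ?_⟩
    rw [List.mem_singleton.1 hob] at hx
    cases hx
    cases hj with
    | br b hp => exact .br hp hargs
  | br_execute_incorrect hi hf hargs hb =>
    obtain ⟨l₁, l₂, rfl, rfl⟩ := h.isList.exists_split hi
    rw [Config.resolvesCond_iff h.isList.eq] at hargs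
    refine ⟨l₁, _, l₂, rfl, fun pc pc' hj => ?_⟩
    rcases List.mem_cons.1 hob with rfl | hob
    · exact hx.elim
    rw [List.mem_singleton.1 hob] at hx
    cases hx
    cases hj with
    | br b hp => exact .br hp hargs
  | load_execute_nodep hi hf hargs hst hv =>
    obtain ⟨l₁, l₂, rfl, rfl⟩ := h.isList.exists_split hi
    rw [Config.resolvesAddr_iff h.isList.eq] at hargs
    refine ⟨l₁, _, l₂, rfl, fun pc pc' hj => ?_⟩
    rw [List.mem_singleton.1 hob] at hx
    cases hj with
    | load hp => exact .load hp hargs hx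
  | load_execute_forward hi hf hargs hj hst hlast =>
    obtain ⟨l₁, l₂, rfl, rfl⟩ := h.isList.exists_split hi
    rw [Config.resolvesAddr_iff h.isList.eq] at hargs
    refine ⟨l₁, _, l₂, rfl, fun pc pc' hj => ?_⟩
    rw [List.mem_singleton.1 hob] at hx
    cases hj with
    | load hp => exact .load hp hargs hx
  | store_execute_addr_ok hi hf hargs hok =>
    obtain ⟨l₁, l₂, rfl, rfl⟩ := h.isList.exists_split hi
    rw [Config.resolvesAddr_iff h.isList.eq] at hargs
    refine ⟨l₁, _, l₂, rfl, fun pc pc' hj => ?_⟩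
    rw [List.mem_singleton.1 hob] at hx
    cases hj with
    | store hp hs => exact .store hp hargs hx
  | store_execute_addr_hazard hi hf hargs hk hmin =>
    obtain ⟨l₁, l₂, rfl, rfl⟩ := h.isList.exists_split hi
    rw [Config.resolvesAddr_iff h.isList.eq] at hargs
    refine ⟨l₁, _, l₂, rfl, fun pc pc' hj => ?_⟩
    rcases List.mem_cons.1 hob with rfl | hob
    · exact hx.elim
    rw [List.mem_singleton.1 hob] at hx
    cases hj with
    | store hp hs => exact .store hp hargs hx
  -- The address was resolved earlier, but its justification says that the operands yield it in the
  -- current view.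
  | store_retire hi =>
    obtain ⟨-, l', rfl⟩ := h.isList.min_eq hi
    refine ⟨[], _, l', rfl, fun pc pc' hj => ?_⟩
    rw [List.mem_singleton.1 hob] at hx
    cases hj with
    | storeAt hp hs ha => exact .store hp ha hx
  | _ => cases hob

/-- An execution within the speculation bound whose trace contains a label has a step in which
the label is observed. -/
theorem BoundedExec.exists_step (h : BoundedExec M n C D O T) {x : L} (hx : TraceHasLabel O x) :
    ∃ D₀ O₀ C₀ d o C₁, BoundedExec M n C D₀ O₀ C₀ ∧ Step M C₀ d o C₁ ∧ TraceHasLabel o x := by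
  induction h with
  | nil =>
    obtain ⟨_, h, -⟩ := hx
    cases h
  | snoc h hs _ ih =>
    obtain ⟨ob, hob, hl⟩ := hx
    rcases List.mem_append.1 hob with hob | hob
    · exact ih ⟨ob, hob, hl⟩
    · exact ⟨_, _, _, _, _, _, h, hs, ob, hob, hl⟩

theorem BoundedExec.size_le (h : BoundedExec M n C D O T) : T.buf.size ≤ n := by
  cases h <;> assumption

end SpecCT

/-! ### Soundness of the tool -/

theorem mainTheorem4 {V R Op L : Type*} [Lattice L] [OrderBot L] (M : SpecCT.Machine V Op)
    (secret : L) (n : ℕ) (C : SpecCT.Config V R Op L) (hC : C.Initial)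
    (hfence : ∀ m next, C.prog m ≠ some (SpecCT.Instr.fence next))
    (hfault : SpecCT.FaultFree M n C)
    (D : List SpecCT.Directive) (O : List (SpecCT.Obs V L)) (C₁ : SpecCT.Config V R Op L)
    (hD : SpecCT.BoundedExec M n C D O C₁) (hO : SpecCT.TraceHasLabel O secret) :
    ∃ Dt ∈ SpecCT.ToolSchedules M C n, ∃ Ot Ct,
      SpecCT.Exec M C Dt Ot Ct ∧ SpecCT.TraceHasLabel Ot secret := by
  obtain ⟨D₀, O₀, C₀, d, o, C₂, h₀, hs, ho⟩ := hD.exists_step hO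
  obtain ⟨past, pc₁, base, l, ht⟩ := h₀.exists_trail hC hfence
  have hl : l.length ≤ n := ht.isList.size ▸ h₀.size_le
  obtain ⟨l₁, t, l₂, rfl, hleak⟩ := ht.exists_leaks hs ho
  simp only [List.length_append, List.length_cons] at hl
  obtain ⟨pc₂, h₁, h₂⟩ := SpecCT.Hist.append_iff.1 ht.pending
  obtain ⟨pc₃, hj, -⟩ := SpecCT.Hist.cons_iff.1 h₂
  have hE : SpecCT.Hist M C.prog C.view C.pc (past ++ l₁) pc₂ :=
    SpecCT.Hist.append_iff.2 ⟨pc₁, ht.retired, ht.view.symm ▸ h₁⟩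
  -- As `l₁`, `t` and `l₂` fit into `n` entries, `n` is positive and `l₁` has at most `n - 1`. An
  -- entry with at least `n - 1` successors therefore lies in `past`, so it is fully resolved.
  obtain ⟨Dt, Ot, T, base', lt, -, -, hT, hlt, rfl, hle, -⟩ :=
    SpecCT.exists_toolRun hC hfault (by omega) hE fun E₀ e E₁ hEq hn => by
      have hlen := congrArg List.length hEq
      simp only [List.length_append, List.length_cons] at hlen
      refine ht.full e ?_
      have hpre : E₀ ++ [e] <+: past := by
        refine List.prefix_of_prefix_length_le (l₃ := past ++ l₁) ⟨E₁, ?_⟩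
          (List.prefix_append _ _) (by simp; omega)
        simp [hEq]
      exact hpre.subset (by simp)
  rw [SpecCT.View.applyAll_append, ht.view] at hle
  exact hT.leak hfault hlt (hleak _ _ hj) hle
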